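/- Let $d\ge 1$ and let $\mathcal P=\{p(i,j)\}_{i,j\in\mathbb Z^d}$ be a stochastic matrix which is homogeneous ($p(i,j)=p(0,j-i)=:p(j-i)$), centered ($\sum_j j\,p(j)=0$), of finite range ($p(j)=0$ for all $|j|>v$, for some $v$), and truly $d$-dimensional ($\{j:p(j)\ne0\}$ generates the group $\mathbb Z^d$). Let $\varepsilon_n(i)$, $n\in\mathbb N$, $i\in\mathbb Z^d$, be i.i.d. integrable symmetric real random variables with law $F$. The wall process is defined by $W_0(i)=0$ and $$W_n(i)=\Big(\sum_{j\in\mathbb Z^d}p(i,j)W_{n-1}(j)+\varepsilon_n(i)\Big)^+,\qquad n\ge1,\ i\in\mathbb Z^d,$$ and $\mu_n:=\mathbb E\,W_n(0)$. Write $\bar F(x)=F((x,\infty))$. For $\alpha>0$, let $\mathcal L_\alpha^-$ (respectively $\mathcal L_\alpha^+$) be the class of laws $F$ for which there are $a,a'>0$ with $\bar F(x)\le a e^{-a'x^\alpha}$ (respectively $\bar F(x)\ge a e^{-a'x^\alpha}$) for all $x>0$, and let $\mathcal L_\alpha=\mathcal L_\alpha^-\cap\mathcal L_\alpha^+$. Then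 there exist constants $0<c,C<\infty$, depending on $d$, $\mathcal P$ and $F$ but not on $n$, such that: (i) if $d=1$, $F\in\mathcal L_1^-$ and $F\neq\delta_0$, then $c\,n^{1/4}\le\mu_n\le C\,n^{1/4}\sqrt{\log n}$ for all $n\ge2$; (ii) if $d=2$ and $F\in\mathcal L_\alpha$ for some $\alpha\ge1$, then $c(\log n)^{\frac1\alpha\vee\frac12}\le\mu_n\le C\log n$ for all $n\ge2$; (iii) if $d\ge3$ and $F\in\mathcal L_\alpha$ for some $\alpha\ge1$ with $\alpha\ne1+d/2$, then $c(\log n)^{\frac1\alpha}\le\mu_n\le C(\log n)^{\frac1\alpha\vee\frac2{2+d}}$ for all $n\ge2$; (iv) if $d\ge3$ and $F\in\mathcal L_{1+d/2}$, then $c(\log n)^{\frac2{2+d}}\le\mu_n\le C(\log n)^{\frac2{2+d}}(\log\log n)^{\frac d{2+d}}$ for all $n\ge3$. -/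

import Mathlib

open MeasureTheory ProbabilityTheory

/-- A homogeneous, centered, finite-range and truly `d`-dimensional stochastic matrix on `ℤ^d`;
the increment law is `p j = P 0 j`. -/
structure IsHarnessMatrix {d : ℕ} (P : (Fin d → ℤ) → (Fin d → ℤ) → ℝ) : Prop where
  nonneg : ∀ i j, 0 ≤ P i j
  stochastic : ∀ i, HasSum (fun j => P i j) 1
  homogeneous : ∀ i j, P i j = P 0 (j - i)
  centered : ∀ k : Fin d, HasSum (fun j : Fin d → ℤ => (j k : ℝ) * P 0 j) 0
  finite_range : ∃ v : ℝ, ∀ j : Fin d → ℤ, v < ‖j‖ → P 0 j = 0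
  generates : AddSubgroup.closure {j : Fin d → ℤ | P 0 j ≠ 0} = ⊤

/-- The variables `ε n i`, for `n ∈ ℕ` and `i ∈ ℤ^d`, are independent with common law `F`, where
`F` is integrable and symmetric. -/
structure IsNoise {d : ℕ} {Ω : Type*} [MeasurableSpace Ω] (Pr : Measure Ω) (F : Measure ℝ)
    (ε : ℕ → (Fin d → ℤ) → Ω → ℝ) : Prop where
  hasLaw : ∀ n i, HasLaw (ε n i) F Pr
  indep : iIndepFun (fun q : ℕ × (Fin d → ℤ) => ε q.1 q.2) Pr
  integrable : Integrable (fun x : ℝ => x) F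
  symmetric : F.map (fun x : ℝ => -x) = F

/-- The wall process: `W_0 = 0` and `W_n(i) = (∑_j P(i,j) W_{n-1}(j) + ε_n(i))⁺`. For a matrix of
finite range the sum over `j` has only finitely many nonzero terms. -/
noncomputable def wallProcess {d : ℕ} {Ω : Type*} (P : (Fin d → ℤ) → (Fin d → ℤ) → ℝ)
    (ε : ℕ → (Fin d → ℤ) → Ω → ℝ) : ℕ → (Fin d → ℤ) → Ω → ℝ
  | 0 => fun _ _ => 0
  | n + 1 => fun i ω => max ((∑' j, P i j * wallProcess P ε n j ω) + ε (n + 1) i ω) 0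

/-- The mean height `μ_n = 𝔼 W_n(0)` of the wall process at the origin. -/
noncomputable def meanHeight {d : ℕ} {Ω : Type*} [MeasurableSpace Ω] (Pr : Measure Ω)
    (P : (Fin d → ℤ) → (Fin d → ℤ) → ℝ) (ε : ℕ → (Fin d → ℤ) → Ω → ℝ) (n : ℕ) : ℝ :=
  ∫ ω, wallProcess P ε n 0 ω ∂Pr

/-- The class `𝓛_α⁻` of laws whose right tail is at most `c * exp (-c' * x ^ α)`, `x > 0`. -/
def TailClassMinus (α : ℝ) : Set (Measure ℝ) :=
  {F | ∃ c > 0, ∃ c' > 0, ∀ x : ℝ, 0 < x → F.real (Set.Ioi x) ≤ c * Real.exp (-c' * x ^ α)}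

/-- The class `𝓛_α⁺` of laws whose right tail is at least `c * exp (-c' * x ^ α)`, `x > 0`. -/
def TailClassPlus (α : ℝ) : Set (Measure ℝ) :=
  {F | ∃ c > 0, ∃ c' > 0, ∀ x : ℝ, 0 < x → c * Real.exp (-c' * x ^ α) ≤ F.real (Set.Ioi x)}

/-- The class `𝓛_α = 𝓛_α⁻ ∩ 𝓛_α⁺`. -/
def TailClass (α : ℝ) : Set (Measure ℝ) := TailClassMinus α ∩ TailClassPlus α

/-! Without the wall the height is the linear process `freeHeight`, V_n(i) = Σ_k Σ_x p_k(x)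
ε_{n-k}(i+x), where p_k is the k-step law of the walk. Its variance is that of F times the collision
number Σ_{k<n} Σ_x p_k(x)². The inner sum has order k^{-d/2}: from below by Chebyshev and
Cauchy–Schwarz, from above by the Fourier bound p_k ≤ K (k+1)^{-d/2}. Hence the collision number has
order √n for d = 1, log n for d = 2, and is bounded for d ≥ 3.

Upper bounds. W exceeds V by at most the maximum of -V over the past cone of influence
(`wallProcess_le_freeHeight_add`), which has polynomially many points. If E exp(-tV) ≤ exp(A) on the
cone, a union bound gives μ_n ≤ (D log n + A)/t (`exists_meanHeight_le_of_exp_moment`), and t is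
then optimised. For d ≤ 2, and for α = 1, it suffices to use small t, where A is t² times the
collision number. For d ≥ 3 and α > 1, large t is needed. The log-moment generating function of F is
at most quadratic near 0 and at most of order s^β at infinity, with β = α/(α-1). Inserting p_k ≲
k^{-d/2}, the main contribution comes from bounded k if α < 1 + d/2 (A of order t^β), and from k
near t^{2/d}, where t p_k crosses 1, if α > 1 + d/2 (A of order t^{1+2/d}). At equality all scales
up to t^{2/d} contribute equally, which costs a logarithm.

Lower bounds. Since W ≥ V⁺ and the fourth moment of V is at most a multiple of the square of the
collision number, μ_n is at least of the order of the standard deviation of V. In every dimension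
the wall also raises the mean by at least F̄(2μ_n+2)/2 per step (`meanHeight_succ_ge`). So n
F̄(2μ_n+2) ≤ 2μ_n, which forces μ_n to be at least of order (log n)^{1/α}. -/

/-! ### Transition probabilities of the walk: moments and the diffusive lower bound -/

/-- The step law of a centered random walk on `ℤ^d` with finite support `S` generating `ℤ^d`. -/
structure IsStepLaw {d : ℕ} (S : Finset (Fin d → ℤ)) (p : (Fin d → ℤ) → ℝ) : Prop where
  pos : ∀ y ∈ S, 0 < p y
  sum_eq_one : ∑ y ∈ S, p y = 1
  centered : ∀ l, ∑ y ∈ S, p y * (y l : ℝ) = 0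
  generates : AddSubgroup.closure (S : Set (Fin d → ℤ)) = ⊤

/-- The `k`-step transition probability from `0` to `x` of the random walk with step law `p`. -/
noncomputable def walkProb {d : ℕ} (S : Finset (Fin d → ℤ)) (p : (Fin d → ℤ) → ℝ) :
    ℕ → (Fin d → ℤ) → ℝ
  | 0 => fun x => if x = 0 then 1 else 0
  | k + 1 => fun x => ∑ y ∈ S, p y * walkProb S p k (x - y)

section Walk

variable {d : ℕ} {S : Finset (Fin d → ℤ)} {p : (Fin d → ℤ) → ℝ}

theorem walkProb_finite_support (k : ℕ) : (Function.support (walkProb S p k)).Finite := by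
  induction k with
  | zero =>
    refine (Set.finite_singleton (0 : Fin d → ℤ)).subset fun x hx => ?_
    by_contra h
    exact hx (if_neg h)
  | succ k ih =>
    refine (S.finite_toSet.biUnion fun y _ => ih.image (· + y)).subset fun x hx => ?_
    obtain ⟨y, hy, h⟩ := Finset.exists_ne_zero_of_sum_ne_zero hx
    simp only [Set.mem_iUnion]
    exact ⟨y, hy, x - y, right_ne_zero_of_mul h, by simp⟩

theorem walkProb_mul_summable (k : ℕ) (f : (Fin d → ℤ) → ℝ) :
    Summable fun x => walkProb S p k x * f x :=
  summable_of_hasFiniteSupport ((walkProb_finite_support k).subset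
    (Function.support_mul_subset_left _ _))

theorem walkProb_summable (k : ℕ) : Summable (walkProb S p k) :=
  summable_of_hasFiniteSupport (walkProb_finite_support k)

theorem walkProb_sq_summable (k : ℕ) : Summable fun x => walkProb S p k x ^ 2 := by
  simpa [sq] using walkProb_mul_summable (S := S) (p := p) k (walkProb S p k)

theorem walkProb_tsum_zero (f : (Fin d → ℤ) → ℝ) : ∑' x, walkProb S p 0 x * f x = f 0 := by
  rw [tsum_eq_single 0]
  · simp [walkProb]
  · intro x hx
    simp [walkProb, hx]

/-- The one-step recursion for expectations along the walk. It drives the moment computations below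
and the recursion of the free process. -/
theorem walkProb_tsum_succ (k : ℕ) (f : (Fin d → ℤ) → ℝ) :
    ∑' x, walkProb S p (k + 1) x * f x =
      ∑ y ∈ S, p y * ∑' x, walkProb S p k x * f (x + y) := by
  have h (y : Fin d → ℤ) : ∑' x, walkProb S p k (x - y) * f x =
      ∑' x, walkProb S p k x * f (x + y) := by
    rw [← (Equiv.addRight y).tsum_eq]
    simp
  have hs (y : Fin d → ℤ) : Summable fun x => walkProb S p k (x - y) * f x := by
    rw [← (Equiv.addRight y).summable_iff]
    simpa [Function.comp_def] using walkProb_mul_summable k fun x => f (x + y)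
  simp_rw [← h, ← tsum_mul_left]
  rw [← Summable.tsum_finsetSum fun y _ => (hs y).mul_left _]
  refine tsum_congr fun x => ?_
  simp [walkProb, Finset.sum_mul, mul_assoc]

variable (h : IsStepLaw S p)
include h

theorem IsStepLaw.walkProb_nonneg (k : ℕ) (x : Fin d → ℤ) : 0 ≤ walkProb S p k x := by
  induction k generalizing x with
  | zero => simp only [walkProb]; split_ifs <;> norm_num
  | succ k ih => exact Finset.sum_nonneg fun y hy => mul_nonneg (h.pos y hy).le (ih _)

theorem IsStepLaw.tsum_walkProb (k : ℕ) : ∑' x, walkProb S p k x = 1 := by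
  induction k with
  | zero => simpa using walkProb_tsum_zero (S := S) (p := p) fun _ => 1
  | succ k ih =>
    have := walkProb_tsum_succ (S := S) (p := p) k fun _ => 1
    simp only [mul_one, ih] at this
    rw [this, h.sum_eq_one]

theorem IsStepLaw.sum_walkProb_le (k : ℕ) (B : Finset (Fin d → ℤ)) :
    ∑ x ∈ B, walkProb S p k x ≤ 1 :=
  h.tsum_walkProb k ▸ (walkProb_summable k).sum_le_tsum B fun x _ => h.walkProb_nonneg k x

theorem IsStepLaw.walkProb_le_one (k : ℕ) (x : Fin d → ℤ) : walkProb S p k x ≤ 1 := by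
  simpa using h.sum_walkProb_le k {x}

theorem IsStepLaw.tsum_walkProb_coord (k : ℕ) (l : Fin d) :
    ∑' x, walkProb S p k x * (x l : ℝ) = 0 := by
  induction k with
  | zero => simpa using walkProb_tsum_zero (S := S) (p := p) fun x => (x l : ℝ)
  | succ k ih =>
    rw [walkProb_tsum_succ (S := S) (p := p) k fun x => (x l : ℝ), ← h.centered l]
    refine Finset.sum_congr rfl fun y _ => ?_
    simp only [Pi.add_apply, Int.cast_add, mul_add]
    rw [(walkProb_mul_summable k _).tsum_add (walkProb_mul_summable k _), ih, tsum_mul_right,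
      h.tsum_walkProb, zero_add, one_mul]

theorem IsStepLaw.tsum_walkProb_coord_sq (k : ℕ) (l : Fin d) :
    ∑' x, walkProb S p k x * (x l : ℝ) ^ 2 = k * ∑ y ∈ S, p y * (y l : ℝ) ^ 2 := by
  induction k with
  | zero =>
    rw [walkProb_tsum_zero fun x => (x l : ℝ) ^ 2]
    simp
  | succ k ih =>
    rw [walkProb_tsum_succ (S := S) (p := p) k fun x => (x l : ℝ) ^ 2]
    have (y : Fin d → ℤ) : ∑' x, walkProb S p k x * (((x + y) l : ℤ) : ℝ) ^ 2 =
        (k * ∑ y ∈ S, p y * (y l : ℝ) ^ 2) + (y l : ℝ) ^ 2 := by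
      have e (x : Fin d → ℤ) : walkProb S p k x * (((x + y) l : ℤ) : ℝ) ^ 2 =
          walkProb S p k x * (x l : ℝ) ^ 2 + ((walkProb S p k x * (x l : ℝ)) * (2 * y l) +
            walkProb S p k x * (y l : ℝ) ^ 2) := by
        simp only [Pi.add_apply, Int.cast_add]; ring
      simp_rw [e]
      rw [(walkProb_mul_summable k _).tsum_add (((walkProb_mul_summable k _).mul_right _).add
        (walkProb_mul_summable k _)), ((walkProb_mul_summable k _).mul_right _).tsum_add
        (walkProb_mul_summable k _), tsum_mul_right, tsum_mul_right, h.tsum_walkProb_coord,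
        h.tsum_walkProb, ih]
      ring
    simp_rw [this, mul_add, Finset.sum_add_distrib, ← Finset.sum_mul, h.sum_eq_one]
    push_cast
    ring

/-- A diffusive lower bound for the return probability of the symmetrized walk. -/
theorem IsStepLaw.exists_le_tsum_walkProb_sq :
    ∃ c : ℝ, 0 < c ∧ ∀ k : ℕ,
      c * ((k : ℝ) + 1) ^ (-((d : ℝ) / 2)) ≤ ∑' x, walkProb S p k x ^ 2 := by
  set σ : ℝ := ∑ l : Fin d, ∑ y ∈ S, p y * (y l : ℝ) ^ 2 with hσ
  have hσ0 : 0 ≤ σ := Finset.sum_nonneg fun l _ => Finset.sum_nonneg fun y hy =>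
    mul_nonneg (h.pos y hy).le (sq_nonneg _)
  set D : ℝ := 2 * √(2 * σ) + 3
  have hD : 0 < D := by positivity
  refine ⟨1 / (4 * D ^ d), by positivity, fun k => ?_⟩
  -- The squared displacement has mean σk, so a box of this radius keeps half of the mass.
  -- Cauchy–Schwarz on the box then gives at least (1/2)² divided by its cardinality, which is where
  -- the 4 in the constant comes from.
  set r : ℕ := ⌈√(2 * σ * k)⌉₊
  have hr : √(2 * σ * k) ≤ r := Nat.le_ceil _
  have hr' : (r : ℝ) < √(2 * σ * k) + 1 := Nat.ceil_lt_add_one (by positivity)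
  have hr2 : 2 * σ * k ≤ ((r : ℝ) + 1) ^ 2 := by
    calc 2 * σ * k = √(2 * σ * k) ^ 2 := (Real.sq_sqrt (by positivity)).symm
      _ ≤ ((r : ℝ) + 1) ^ 2 := by gcongr; linarith
  set B : Finset (Fin d → ℤ) := Finset.Icc (fun _ => -(r : ℤ)) (fun _ => (r : ℤ)) with hB
  have hcard : (B.card : ℝ) = (2 * r + 1) ^ d := by
    rw [hB, Pi.card_Icc]
    simp only [Int.card_Icc, Finset.prod_const, Finset.card_univ, Fintype.card_fin]
    rw [show ((r : ℤ) + 1 - -(r : ℤ)).toNat = 2 * r + 1 by omega]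
    push_cast
    ring
  have hmass : 1 / 2 ≤ ∑ x ∈ B, walkProb S p k x := by
    -- Chebyshev: an integer point outside the box has a coordinate of size at least r + 1, so the
    -- second summand is at least 1 there.
    have h1 : ∑' x, walkProb S p k x * ((if x ∈ B then 1 else 0) +
        ∑ l, (x l : ℝ) ^ 2 * (1 / ((r : ℝ) + 1) ^ 2)) ≥ ∑' x, walkProb S p k x := by
      refine (walkProb_summable k).tsum_le_tsum (fun x => ?_) (walkProb_mul_summable k _)
      refine le_mul_of_one_le_right (h.walkProb_nonneg k x) ?_
      split_ifs with hx
      · have : 0 ≤ ∑ l, (x l : ℝ) ^ 2 * (1 / ((r : ℝ) + 1) ^ 2) :=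
          Finset.sum_nonneg fun l _ => by positivity
        linarith
      · have : ∃ l, (r : ℤ) + 1 ≤ |x l| := by
          by_contra! hc
          refine hx (Finset.mem_Icc.2 ⟨fun l => ?_, fun l => ?_⟩) <;>
            have := abs_le.1 (Int.lt_add_one_iff.1 (hc l))
          · exact this.1
          · exact this.2
        obtain ⟨l, hl⟩ := this
        have hl' : ((r : ℝ) + 1) ≤ |(x l : ℝ)| := by exact_mod_cast hl
        have : (1 : ℝ) ≤ (x l : ℝ) ^ 2 * (1 / ((r : ℝ) + 1) ^ 2) := by
          rw [mul_one_div, one_le_div (by positivity), ← sq_abs (x l : ℝ)]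
          gcongr
        have h3 := Finset.single_le_sum (f := fun l => (x l : ℝ) ^ 2 * (1 / ((r : ℝ) + 1) ^ 2))
          (fun l _ => by positivity) (Finset.mem_univ l)
        linarith
    rw [h.tsum_walkProb] at h1
    simp_rw [mul_add, Finset.mul_sum] at h1
    rw [(walkProb_mul_summable k _).tsum_add (summable_sum fun l _ => walkProb_mul_summable k _),
      Summable.tsum_finsetSum (fun l _ => walkProb_mul_summable k _)] at h1
    simp_rw [← mul_assoc, tsum_mul_right, h.tsum_walkProb_coord_sq] at h1
    rw [← Finset.sum_mul, ← Finset.mul_sum, ← hσ] at h1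
    have h4 : ∑' x, walkProb S p k x * (if x ∈ B then 1 else 0) = ∑ x ∈ B, walkProb S p k x := by
      rw [tsum_eq_sum (s := B)]
      · exact Finset.sum_congr rfl fun x hx => by simp [hx]
      · intro x hx; simp [hx]
    have h5 : k * σ * (1 / ((r : ℝ) + 1) ^ 2) ≤ 1 / 2 := by
      rw [mul_one_div, div_le_iff₀ (by positivity)]
      linarith
    linarith
  have hcs : (∑ x ∈ B, walkProb S p k x) ^ 2 ≤ B.card * ∑ x ∈ B, walkProb S p k x ^ 2 :=
    sq_sum_le_card_mul_sum_sq
  have hle : ∑ x ∈ B, walkProb S p k x ^ 2 ≤ ∑' x, walkProb S p k x ^ 2 :=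
    (walkProb_sq_summable k).sum_le_tsum B fun x _ => sq_nonneg _
  have hk : (0 : ℝ) < √((k : ℝ) + 1) := by positivity
  have hrD : 2 * (r : ℝ) + 1 ≤ D * √((k : ℝ) + 1) := by
    have h1 : √(2 * σ * k) ≤ √(2 * σ) * √((k : ℝ) + 1) := by
      rw [← Real.sqrt_mul (by positivity)]
      exact Real.sqrt_le_sqrt (by nlinarith)
    have h2 : 1 ≤ √((k : ℝ) + 1) := by rw [Real.one_le_sqrt]; linarith [k.cast_nonneg (α := ℝ)]
    simp only [D]
    nlinarith
  have hpow : (B.card : ℝ) ≤ D ^ d * ((k : ℝ) + 1) ^ ((d : ℝ) / 2) := by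
    rw [hcard]
    calc (2 * (r : ℝ) + 1) ^ d ≤ (D * √((k : ℝ) + 1)) ^ d := by gcongr
      _ = D ^ d * ((k : ℝ) + 1) ^ ((d : ℝ) / 2) := by
        rw [mul_pow, Real.sqrt_eq_rpow, ← Real.rpow_natCast (_ ^ (1 / 2 : ℝ)),
          ← Real.rpow_mul (by positivity)]
        congr 2; ring
  have hX : (0 : ℝ) < ((k : ℝ) + 1) ^ ((d : ℝ) / 2) := by positivity
  rw [Real.rpow_neg (by positivity), one_div, ← mul_inv, inv_le_iff_one_le_mul₀ (by positivity)]
  have h6 : (1 / 2 : ℝ) ^ 2 ≤ (∑ x ∈ B, walkProb S p k x) ^ 2 := by gcongr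
  have h7 : (B.card : ℝ) * ∑ x ∈ B, walkProb S p k x ^ 2 ≤
      (D ^ d * ((k : ℝ) + 1) ^ ((d : ℝ) / 2)) * ∑' x, walkProb S p k x ^ 2 := by
    gcongr
  nlinarith

end Walk

/-! ### Fourier analysis on the torus -/

section Torus

open UnitAddTorus AddCircle

/-- The normalized Haar measure on the torus `(ℝ / ℤ)^d`. -/
noncomputable def torusMeasure (d : ℕ) : Measure (UnitAddTorus (Fin d)) :=
  Measure.pi fun _ => haarAddCircle

instance (d : ℕ) : IsProbabilityMeasure (torusMeasure d) := by
  unfold torusMeasure; infer_instance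

instance (d : ℕ) : (torusMeasure d).IsAddHaarMeasure := by
  unfold torusMeasure; infer_instance

theorem integral_fourier_eq (n : ℤ) :
    ∫ t : UnitAddCircle, fourier n t ∂haarAddCircle = if n = 0 then (1 : ℂ) else 0 := by
  split_ifs with hn
  · simp [hn]
  · exact integral_eq_zero_of_add_right_eq_neg (fourier_add_half_inv_index hn one_pos)

theorem norm_mFourier_apply {d : ℕ} (x : Fin d → ℤ) (θ : UnitAddTorus (Fin d)) :
    ‖mFourier x θ‖ = 1 := by
  simp only [mFourier, fourier_apply, ContinuousMap.coe_mk, norm_prod, Circle.norm_coe,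
    Finset.prod_const_one]

theorem integral_mFourier_eq {d : ℕ} (x : Fin d → ℤ) :
    ∫ θ, mFourier x θ ∂torusMeasure d = if x = 0 then (1 : ℂ) else 0 := by
  have : ∫ θ, mFourier x θ ∂torusMeasure d = ∏ i, if x i = 0 then (1 : ℂ) else 0 := by
    simp only [mFourier, ContinuousMap.coe_mk, torusMeasure]
    rw [integral_fintype_prod_eq_prod (fun i (t : UnitAddCircle) => (fourier (x i) t : ℂ))]
    exact Finset.prod_congr rfl fun i _ => integral_fourier_eq (x i)
  rw [this]
  split_ifs with hx
  · simp [hx]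
  · obtain ⟨i, hi⟩ := Function.ne_iff.1 hx
    exact Finset.prod_eq_zero (Finset.mem_univ i) (if_neg hi)

/-- The quadratic bound cos x ≤ 1 - 2x²/π² on [-π, π], taken at x = 2πt. -/
theorem one_sub_re_fourier_one_ge (t : ℝ) (ht : |t| ≤ 1 / 2) :
    8 * t ^ 2 ≤ 1 - (fourier 1 (t : UnitAddCircle) : ℂ).re := by
  have h : (fourier 1 (t : UnitAddCircle) : ℂ).re = Real.cos (2 * Real.pi * t) := by
    rw [fourier_coe_apply, show 2 * (Real.pi : ℂ) * Complex.I * ((1 : ℤ) : ℂ) * (t : ℂ) / ((1 : ℝ) : ℂ)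
      = ((2 * Real.pi * t : ℝ) : ℂ) * Complex.I by push_cast; ring, Complex.exp_ofReal_mul_I_re]
  have hpi := Real.pi_pos
  have h2 := Real.cos_le_one_sub_mul_cos_sq (x := 2 * Real.pi * t) (by
    rw [abs_mul, abs_of_pos (by positivity)]; nlinarith)
  rw [h]
  have : 2 / Real.pi ^ 2 * (2 * Real.pi * t) ^ 2 = 8 * t ^ 2 := by field_simp; ring
  linarith

/-- On the fundamental domain (-1/2, 1/2] the integrand lies below a Gaussian, whose integral is
then extended to the whole line. -/
theorem integral_exp_fourier_le {a : ℝ} (ha : 0 < a) :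
    ∫ t : UnitAddCircle, Real.exp (-(a * (1 - (fourier 1 t : ℂ).re))) ∂haarAddCircle ≤
      √(Real.pi / (8 * a)) := by
  have hvol : (haarAddCircle : Measure UnitAddCircle) = volume := by
    rw [volume_eq_smul_haarAddCircle]; simp
  rw [hvol, ← UnitAddCircle.integral_preimage (-(1 / 2)), ← integral_gaussian]
  have hint : Integrable fun t : ℝ => Real.exp (-(8 * a) * t ^ 2) :=
    integrable_exp_neg_mul_sq (by positivity)
  refine le_trans (setIntegral_mono_on ?_ hint.integrableOn measurableSet_Ioc fun t ht => ?_)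
    (setIntegral_le_integral hint (.of_forall fun _ => (Real.exp_pos _).le))
  · refine Continuous.integrableOn_Ioc ?_
    have : Continuous fun t : ℝ => (fourier 1 (t : UnitAddCircle) : ℂ) :=
      (fourier 1).continuous.comp (AddCircle.continuous_mk' 1)
    fun_prop
  · gcongr
    have := one_sub_re_fourier_one_ge t (abs_le.2 ⟨ht.1.le, by linarith [ht.2]⟩)
    nlinarith

/-- The endomorphism of the torus given by an integer matrix. -/
noncomputable def torusEnd {d : ℕ} (U : Matrix (Fin d) (Fin d) ℤ) :
    UnitAddTorus (Fin d) →+ UnitAddTorus (Fin d) where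
  toFun θ i := ∑ l, U i l • θ l
  map_zero' := by ext; simp
  map_add' θ η := by ext i; simp [Finset.sum_add_distrib]

theorem torusEnd_mul {d : ℕ} (U V : Matrix (Fin d) (Fin d) ℤ) (θ : UnitAddTorus (Fin d)) :
    torusEnd (U * V) θ = torusEnd U (torusEnd V θ) := by
  ext i
  simp only [torusEnd, AddMonoidHom.coe_mk, ZeroHom.coe_mk, Matrix.mul_apply, Finset.sum_smul,
    Finset.smul_sum, mul_smul]
  exact Finset.sum_comm

/-- The adjugate inverts `U` up to the factor det U, and the circle is divisible. -/
theorem torusEnd_surjective {d : ℕ} {U : Matrix (Fin d) (Fin d) ℤ} (hU : U.det ≠ 0) :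
    Function.Surjective (torusEnd U) := by
  intro η
  have hdiv (t : UnitAddCircle) : ∃ s : UnitAddCircle, U.det • s = t := by
    induction t using QuotientAddGroup.induction_on with
    | H t =>
      refine ⟨((t / U.det : ℝ) : UnitAddCircle), ?_⟩
      rw [← AddCircle.coe_zsmul, zsmul_eq_mul, mul_div_cancel₀ _ (by exact_mod_cast hU)]
  choose g hg using hdiv
  refine ⟨torusEnd U.adjugate fun l => g (η l), ?_⟩
  rw [← torusEnd_mul, Matrix.mul_adjugate]
  ext i
  simp [torusEnd, Matrix.smul_apply, Matrix.one_apply, ite_smul, hg]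

/-- A surjective continuous endomorphism of a compact group preserves normalized Haar measure. So a
nonzero determinant is enough for the change of variables; `U` need not be unimodular. -/
theorem torusEnd_measurePreserving {d : ℕ} {U : Matrix (Fin d) (Fin d) ℤ} (hU : U.det ≠ 0) :
    MeasurePreserving (torusEnd U) (torusMeasure d) (torusMeasure d) := by
  refine AddMonoidHom.measurePreserving ?_ (torusEnd_surjective hU) (by simp)
  refine continuous_pi fun i => ?_
  simp only [torusEnd, AddMonoidHom.coe_mk, ZeroHom.coe_mk]
  fun_prop

theorem mFourier_eq_fourier_torusEnd {d : ℕ} (U : Matrix (Fin d) (Fin d) ℤ) (i : Fin d)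
    (θ : UnitAddTorus (Fin d)) : mFourier (U i) θ = fourier 1 (torusEnd U θ i) := by
  simp only [mFourier, ContinuousMap.coe_mk, torusEnd, AddMonoidHom.coe_mk, ZeroHom.coe_mk,
    fourier_apply, one_smul]
  induction (Finset.univ : Finset (Fin d)) using Finset.induction_on with
  | empty => simp
  | insert a s ha ih => rw [Finset.prod_insert ha, Finset.sum_insert ha, toCircle_add, ih]; simp

/-- After the change of variables by `U`, the characters given by its rows become the coordinate
characters, and the integral factors into `d` one-dimensional ones. -/
theorem integral_prod_exp_mFourier_le {d : ℕ} {U : Matrix (Fin d) (Fin d) ℤ} (hU : U.det ≠ 0)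
    {a : ℝ} (ha : 0 < a) :
    ∫ θ, Real.exp (-(a * ∑ i, (1 - (mFourier (U i) θ).re))) ∂torusMeasure d ≤
      √(Real.pi / (8 * a)) ^ d := by
  set g : UnitAddCircle → ℝ := fun t => Real.exp (-(a * (1 - (fourier 1 t : ℂ).re))) with hg
  have hgc : Continuous g := by fun_prop
  have h1 (θ : UnitAddTorus (Fin d)) : Real.exp (-(a * ∑ i, (1 - (mFourier (U i) θ).re))) =
      ∏ i, g (torusEnd U θ i) := by
    simp_rw [hg, ← Real.exp_sum, mFourier_eq_fourier_torusEnd, Finset.mul_sum,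
      Finset.sum_neg_distrib]
  simp_rw [h1]
  have hmp := torusEnd_measurePreserving hU
  have h2 := integral_map (μ := torusMeasure d) hmp.measurable.aemeasurable
    (f := fun η : UnitAddTorus (Fin d) => ∏ i, g (η i))
    (Continuous.aestronglyMeasurable (by fun_prop))
  rw [hmp.map_eq] at h2
  rw [← h2, torusMeasure, integral_fintype_prod_eq_pow, Fintype.card_fin]
  gcongr
  exact integral_exp_fourier_le ha

end Torus

/-! ### The heat kernel upper bound -/

section HeatKernel

open UnitAddTorus

variable {d : ℕ} {S : Finset (Fin d → ℤ)} {p : (Fin d → ℤ) → ℝ}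

/-- The characteristic function of the step law `p`. -/
noncomputable def charStep (S : Finset (Fin d → ℤ)) (p : (Fin d → ℤ) → ℝ)
    (θ : UnitAddTorus (Fin d)) : ℂ := ∑ y ∈ S, p y * mFourier y θ

theorem continuous_charStep : Continuous (charStep S p) := by
  unfold charStep; fun_prop

/-- Fourier inversion, by induction: each step of the walk contributes one more factor of the
characteristic function. -/
theorem walkProb_eq_integral (k : ℕ) (x : Fin d → ℤ) :
    (walkProb S p k x : ℂ) = ∫ θ, mFourier (-x) θ * charStep S p θ ^ k ∂torusMeasure d := by
  induction k generalizing x with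
  | zero =>
    simp only [walkProb, pow_zero, mul_one, integral_mFourier_eq, neg_eq_zero]
    split_ifs <;> simp
  | succ k ih =>
    have hint (y : Fin d → ℤ) : Integrable
        (fun θ => (p y : ℂ) * (mFourier (-(x - y)) θ * charStep S p θ ^ k)) (torusMeasure d) := by
      have := continuous_charStep (S := S) (p := p)
      exact Continuous.integrable_of_hasCompactSupport (by fun_prop)
        (HasCompactSupport.of_compactSpace _)
    simp only [walkProb, Complex.ofReal_sum, Complex.ofReal_mul, ih, ← integral_const_mul]
    rw [← integral_finsetSum _ fun y _ => hint y]
    congr 1 with θ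
    rw [pow_succ', charStep, Finset.sum_mul, Finset.mul_sum]
    refine Finset.sum_congr rfl fun y _ => ?_
    rw [show -(x - y) = -x + y by abel, mFourier_add]
    ring

theorem walkProb_le_integral (k : ℕ) (x : Fin d → ℤ) :
    walkProb S p k x ≤ ∫ θ, ‖charStep S p θ‖ ^ k ∂torusMeasure d := by
  calc walkProb S p k x ≤ ‖(walkProb S p k x : ℂ)‖ := by
        rw [Complex.norm_real]; exact le_abs_self _
    _ ≤ ∫ θ, ‖mFourier (-x) θ * charStep S p θ ^ k‖ ∂torusMeasure d := by
        rw [walkProb_eq_integral]; exact norm_integral_le_integral_norm _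
    _ = ∫ θ, ‖charStep S p θ‖ ^ k ∂torusMeasure d := by
        congr 1 with θ
        rw [norm_mul, norm_pow, norm_mFourier_apply, one_mul]

/-- The squared modulus is the characteristic function of the difference of two independent steps.
Working with differences means that no aperiodicity is needed: the modulus may equal 1 away from the
origin. -/
theorem IsStepLaw.normSq_charStep (h : IsStepLaw S p) (θ : UnitAddTorus (Fin d)) :
    ‖charStep S p θ‖ ^ 2 =
      1 - ∑ z ∈ S ×ˢ S, p z.1 * p z.2 * (1 - (mFourier (z.1 - z.2) θ).re) := by
  have h1 : ∑ z ∈ S ×ˢ S, p z.1 * p z.2 = 1 := by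
    rw [Finset.sum_product, ← Finset.sum_mul_sum, h.sum_eq_one, one_mul]
  simp_rw [mul_sub, mul_one, Finset.sum_sub_distrib, h1, sub_sub_cancel]
  have h2 : ((‖charStep S p θ‖ ^ 2 : ℝ) : ℂ) =
      ∑ z ∈ S ×ˢ S, (p z.1 * p z.2 : ℝ) * mFourier (z.1 - z.2) θ := by
    push_cast
    rw [← Complex.mul_conj', charStep, map_sum, Finset.sum_mul_sum, Finset.sum_product]
    refine Finset.sum_congr rfl fun y _ => Finset.sum_congr rfl fun z _ => ?_
    rw [sub_eq_add_neg, mFourier_add, mFourier_neg, map_mul, Complex.conj_ofReal]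
    ring
  have h3 := congrArg Complex.re h2
  rw [Complex.ofReal_re, Complex.re_sum] at h3
  rw [h3]
  simp only [Complex.re_ofReal_mul]

/-- Centering gives x = Σ_y p(y)(x - y) for every step x, so the differences of steps span all steps
over ℝ and hence the whole space. A basis extracted from them gives the rows of the matrix. -/
theorem IsStepLaw.exists_differences (h : IsStepLaw S p) :
    ∃ u : Fin d → (Fin d → ℤ) × (Fin d → ℤ), (∀ i, u i ∈ S ×ˢ S) ∧ Function.Injective u ∧
      (Matrix.of fun i => (u i).1 - (u i).2).det ≠ 0 := by
  set c : (Fin d → ℤ) →+ (Fin d → ℝ) := (Int.castAddHom ℝ).compLeft (Fin d) with hc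
  set T : Set (Fin d → ℝ) := (fun z : (Fin d → ℤ) × (Fin d → ℤ) => c (z.1 - z.2)) '' (S ×ˢ S : Finset _)
  have hS (x) (hx : x ∈ S) : c x ∈ Submodule.span ℝ T := by
    have : c x = ∑ y ∈ S, p y • c (x - y) := by
      simp_rw [map_sub, smul_sub, Finset.sum_sub_distrib, ← Finset.sum_smul, h.sum_eq_one, one_smul]
      rw [eq_comm, sub_eq_self]
      ext l
      simpa [hc] using h.centered l
    rw [this]
    refine Submodule.sum_mem _ fun y hy => Submodule.smul_mem _ _ (Submodule.subset_span ?_)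
    exact ⟨(x, y), by simp [hx, hy], rfl⟩
  have hall (x : Fin d → ℤ) : c x ∈ Submodule.span ℝ T := by
    have hle : AddSubgroup.closure (S : Set (Fin d → ℤ)) ≤
        (Submodule.span ℝ T).toAddSubgroup.comap c :=
      (AddSubgroup.closure_le _).2 fun x hx => hS x hx
    rw [h.generates] at hle
    exact hle (AddSubgroup.mem_top x)
  have htop : ⊤ ≤ Submodule.span ℝ T := by
    intro x _
    rw [pi_eq_sum_univ x]
    refine Submodule.sum_mem _ fun i _ => Submodule.smul_mem _ _ ?_
    convert hall (fun j => if i = j then 1 else 0)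
    simp [hc]
  set b := Module.Basis.ofSpan htop
  set b' := b.reindex (b.indexEquiv (Pi.basisFun ℝ (Fin d)))
  have hb' (i : Fin d) : ∃ z ∈ S ×ˢ S, c (z.1 - z.2) = b' i := by
    have : b' i ∈ Set.range b := by simp [b']
    exact Module.Basis.ofSpan_subset htop this
  choose u hu hub using hb'
  refine ⟨u, hu, fun i j hij => b'.injective (by rw [← hub, ← hub, hij]), ?_⟩
  have hind : LinearIndependent ℝ (Matrix.of fun i => c ((u i).1 - (u i).2)).row := by
    have hli := b'.linearIndependent
    rw [← show (fun i => c ((u i).1 - (u i).2)) = ⇑b' from funext hub] at hli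
    exact hli
  have hunit := (Matrix.isUnit_iff_isUnit_det _).1
    (Matrix.linearIndependent_rows_iff_isUnit.1 hind)
  intro h0
  refine hunit.ne_zero ?_
  have := congrArg (Int.castRingHom ℝ) h0
  rw [RingHom.map_det, map_zero] at this
  rw [← this]
  congr 1

theorem IsStepLaw.exists_walkProb_le (h : IsStepLaw S p) :
    ∃ K : ℝ, 1 ≤ K ∧ ∀ k x, walkProb S p k x ≤ K * ((k : ℝ) + 1) ^ (-((d : ℝ) / 2)) := by
  obtain ⟨u, hu, hinj, hdet⟩ := h.exists_differences
  set U : Matrix (Fin d) (Fin d) ℤ := Matrix.of fun i => (u i).1 - (u i).2 with hU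
  obtain ⟨δ, hδ, hδp⟩ : ∃ δ > 0, ∀ i, δ ≤ p (u i).1 * p (u i).2 := by
    have hpos (i) : 0 < p (u i).1 * p (u i).2 :=
      mul_pos (h.pos _ (Finset.mem_product.1 (hu i)).1) (h.pos _ (Finset.mem_product.1 (hu i)).2)
    rcases isEmpty_or_nonempty (Fin d) with hd | hd
    · exact ⟨1, one_pos, fun i => hd.elim i⟩
    · obtain ⟨i, hi⟩ := Finite.exists_min fun i => p (u i).1 * p (u i).2
      exact ⟨_, hpos i, hi⟩
  have hre (x : Fin d → ℤ) (θ : UnitAddTorus (Fin d)) : 0 ≤ 1 - (mFourier x θ).re := by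
    have h1 := (Complex.abs_re_le_norm (mFourier x θ))
    rw [norm_mFourier_apply] at h1
    linarith [le_abs_self (mFourier x θ).re]
  -- All pairs but the `d` selected ones are dropped from the nonnegative sum, and 1 - s ≤ exp(-s).
  -- Injectivity of `u` ensures that no pair is counted twice.
  have hφ (θ : UnitAddTorus (Fin d)) :
      ‖charStep S p θ‖ ^ 2 ≤ Real.exp (-(δ * ∑ i, (1 - (mFourier (U i) θ).re))) := by
    rw [h.normSq_charStep]
    refine le_trans ?_ (Real.add_one_le_exp _)
    have h1 : ∑ z ∈ Finset.univ.image u, p z.1 * p z.2 * (1 - (mFourier (z.1 - z.2) θ).re) ≤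
        ∑ z ∈ S ×ˢ S, p z.1 * p z.2 * (1 - (mFourier (z.1 - z.2) θ).re) := by
      refine Finset.sum_le_sum_of_subset_of_nonneg ?_ fun z hz _ => ?_
      · intro z hz
        obtain ⟨i, _, rfl⟩ := Finset.mem_image.1 hz
        exact hu i
      · have := Finset.mem_product.1 hz
        exact mul_nonneg (mul_pos (h.pos _ this.1) (h.pos _ this.2)).le (hre _ _)
    rw [Finset.sum_image fun i _ j _ hij => hinj hij] at h1
    have h2 : δ * ∑ i, (1 - (mFourier (U i) θ).re) ≤
        ∑ i, p (u i).1 * p (u i).2 * (1 - (mFourier ((u i).1 - (u i).2) θ).re) := by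
      rw [Finset.mul_sum]
      exact Finset.sum_le_sum fun i _ => mul_le_mul_of_nonneg_right (hδp i) (hre _ _)
    linarith
  have hφk (k : ℕ) (θ : UnitAddTorus (Fin d)) : ‖charStep S p θ‖ ^ k ≤
      Real.exp (-((δ * k / 2) * ∑ i, (1 - (mFourier (U i) θ).re))) := by
    refine le_of_sq_le_sq ?_ (Real.exp_pos _).le
    rw [← pow_mul, mul_comm k 2, pow_mul, ← Real.exp_nat_mul]
    calc (‖charStep S p θ‖ ^ 2) ^ k ≤ _ := pow_le_pow_left₀ (sq_nonneg _) (hφ θ) k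
      _ = _ := by rw [← Real.exp_nat_mul]; congr 1; push_cast; ring
  set D : ℝ := √(Real.pi / (2 * δ)) ^ d
  have hD : 0 < D := by positivity
  have key (k : ℕ) (hk : 0 < k) (x) : walkProb S p k x ≤ D * ((k : ℝ) + 1) ^ (-((d : ℝ) / 2)) := by
    have hk' : (1 : ℝ) ≤ k := by exact_mod_cast hk
    have hcont := continuous_charStep (S := S) (p := p)
    calc walkProb S p k x ≤ _ := walkProb_le_integral k x
      _ ≤ ∫ θ, Real.exp (-((δ * k / 2) * ∑ i, (1 - (mFourier (U i) θ).re))) ∂torusMeasure d := by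
        refine integral_mono ?_ ?_ (hφk k) <;>
        exact Continuous.integrable_of_hasCompactSupport (by fun_prop)
          (HasCompactSupport.of_compactSpace _)
      _ ≤ √(Real.pi / (8 * (δ * k / 2))) ^ d := integral_prod_exp_mFourier_le hdet (by positivity)
      _ ≤ (√(Real.pi / (2 * δ)) * √(((k : ℝ) + 1)⁻¹)) ^ d := by
        rw [← Real.sqrt_mul (by positivity), ← div_eq_mul_inv, div_div]
        -- This comes down to k + 1 ≤ 2k, hence the restriction to positive `k`; the time 0 is
        -- covered by the 1 in `max 1 D`.
        refine pow_le_pow_left₀ (by positivity) (Real.sqrt_le_sqrt ?_) d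
        refine div_le_div_of_nonneg_left (by positivity) (by positivity) ?_
        nlinarith
      _ = D * ((k : ℝ) + 1) ^ (-((d : ℝ) / 2)) := by
        rw [mul_pow, Real.sqrt_eq_rpow ((k : ℝ) + 1)⁻¹, ← Real.rpow_natCast (_ ^ (1 / 2 : ℝ)),
          ← Real.rpow_mul (by positivity), Real.inv_rpow (by positivity),
          ← Real.rpow_neg (by positivity)]
        congr 2; ring
  refine ⟨max 1 D, le_max_left _ _, fun k x => ?_⟩
  rcases Nat.eq_zero_or_pos k with rfl | hk
  · simpa using Or.inl (h.walkProb_le_one 0 x)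
  · exact (key k hk x).trans (by gcongr; exact le_max_right _ _)

end HeatKernel

/-! ### Exponential moments of the noise -/

section Noise

variable {F : Measure ℝ} [IsProbabilityMeasure F]

theorem measureReal_abs_gt_le {F : Measure ℝ} (hF : F.map (fun x : ℝ => -x) = F) (u : ℝ) :
    F.real {x | u < |x|} ≤ 2 * F.real (Set.Ioi u) := by
  have h1 : {x : ℝ | u < |x|} = Set.Ioi u ∪ (fun x : ℝ => -x) ⁻¹' Set.Ioi u := by
    ext x; simp only [Set.mem_ofPred_eq, lt_abs]; rfl
  have h2 : F.real ((fun x : ℝ => -x) ⁻¹' Set.Ioi u) = F.real (Set.Ioi u) := by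
    conv_rhs => rw [← hF, map_measureReal_apply measurable_neg measurableSet_Ioi]
  rw [h1, two_mul]
  exact (measureReal_union_le _ _).trans (by rw [h2])

/-- Layer-cake formula: with the rate halved to a'/2, the level sets have mass at most 2a t⁻², which
is integrable at infinity. -/
theorem exists_integrable_exp_abs_rpow (hF : F.map (fun x : ℝ => -x) = F) {α : ℝ} (hα : 0 < α)
    (h : F ∈ TailClassMinus α) :
    ∃ b > 0, Integrable (fun x : ℝ => Real.exp (b * |x| ^ α)) F := by
  obtain ⟨a, ha, a', ha', hta⟩ := h
  refine ⟨a' / 2, by positivity, ?_⟩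
  have hmeas : Measurable fun x : ℝ => Real.exp (a' / 2 * |x| ^ α) := by fun_prop
  refine ⟨hmeas.aestronglyMeasurable, ?_⟩
  rw [hasFiniteIntegral_iff_ofReal (.of_forall fun x => (Real.exp_pos _).le),
    lintegral_eq_lintegral_meas_lt F (.of_forall fun x => (Real.exp_pos _).le) hmeas.aemeasurable]
  have hbound (t : ℝ) (ht : 1 < t) : F {x | t < Real.exp (a' / 2 * |x| ^ α)} ≤
      ENNReal.ofReal (2 * a * t ^ (-2 : ℝ)) := by
    have ht0 : 0 < t := by linarith
    have hlog := Real.log_pos ht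
    set u : ℝ := (2 * Real.log t / a') ^ (1 / α)
    have hu : 0 < u := by positivity
    have huα : u ^ α = 2 * Real.log t / a' := by
      rw [← Real.rpow_mul (by positivity), one_div_mul_cancel hα.ne', Real.rpow_one]
    have hsub : {x : ℝ | t < Real.exp (a' / 2 * |x| ^ α)} ⊆ {x | u < |x|} := by
      intro x hx
      have h1 : Real.log t < a' / 2 * |x| ^ α := (Real.log_lt_iff_lt_exp ht0).2 hx
      refine (Real.rpow_lt_rpow_iff hu.le (abs_nonneg x) hα).1 ?_
      rw [huα, div_lt_iff₀ ha']
      linarith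
    rw [← ofReal_measureReal]
    refine ENNReal.ofReal_le_ofReal ?_
    calc F.real {x | t < Real.exp (a' / 2 * |x| ^ α)} ≤ F.real {x | u < |x|} :=
          measureReal_mono hsub
      _ ≤ 2 * F.real (Set.Ioi u) := measureReal_abs_gt_le hF u
      _ ≤ 2 * (a * Real.exp (-a' * u ^ α)) := by gcongr; exact hta u hu
      _ = 2 * a * t ^ (-2 : ℝ) := by
        rw [huα, Real.rpow_def_of_pos ht0, ← mul_assoc]
        congr 2
        field_simp
  have hsplit : Set.Ioi (0 : ℝ) = Set.Ioc 0 1 ∪ Set.Ioi 1 :=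
    (Set.Ioc_union_Ioi_eq_Ioi zero_le_one).symm
  rw [hsplit]
  refine (lintegral_union_le _ _ _).trans_lt (ENNReal.add_lt_top.2 ⟨?_, ?_⟩)
  · calc ∫⁻ t in Set.Ioc (0 : ℝ) 1, F {x | t < Real.exp (a' / 2 * |x| ^ α)}
        ≤ ∫⁻ t in Set.Ioc (0 : ℝ) 1, 1 := lintegral_mono fun t => prob_le_one
      _ < ⊤ := by simp
  · calc ∫⁻ t in Set.Ioi (1 : ℝ), F {x | t < Real.exp (a' / 2 * |x| ^ α)}
        ≤ ∫⁻ t in Set.Ioi (1 : ℝ), ENNReal.ofReal (2 * a * t ^ (-2 : ℝ)) :=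
          setLIntegral_mono' measurableSet_Ioi fun t ht => hbound t ht
      _ < ⊤ := by
        have hint : IntegrableOn (fun t : ℝ => 2 * a * t ^ (-2 : ℝ)) (Set.Ioi 1) :=
          (integrableOn_Ioi_rpow_of_lt (by norm_num) one_pos).const_mul _
        exact hint.lintegral_lt_top

theorem tailClassMinus_subset_one {α : ℝ} (hα : 1 ≤ α) :
    TailClassMinus α ⊆ TailClassMinus 1 := by
  rintro F ⟨a, ha, a', ha', h⟩
  refine ⟨a * Real.exp a', by positivity, a', ha', fun x hx => (h x hx).trans ?_⟩
  rw [mul_assoc, ← Real.exp_add, Real.rpow_one]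
  gcongr
  have : x - 1 ≤ x ^ α := by
    rcases le_total 1 x with h1 | h1
    · have := Real.rpow_le_rpow_of_exponent_le h1 hα
      rw [Real.rpow_one] at this
      linarith
    · linarith [Real.rpow_pos_of_pos hx α]
  nlinarith

theorem exp_le_one_add_add_sq_mul (y : ℝ) : Real.exp y ≤ 1 + y + y ^ 2 * Real.exp |y| := by
  have h := Complex.norm_exp_sub_sum_le_norm_mul_exp (y : ℂ) 2
  rw [show Complex.exp y - ∑ m ∈ Finset.range 2, (y : ℂ) ^ m / (m.factorial : ℂ) =
    ((Real.exp y - (1 + y) : ℝ) : ℂ) by simp [Finset.sum_range_succ], Complex.norm_real,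
    Complex.norm_real, Real.norm_eq_abs, Real.norm_eq_abs, sq_abs] at h
  linarith [le_abs_self (Real.exp y - (1 + y))]

theorem integrable_id_of_exp {F : Measure ℝ} {b : ℝ} (hb : 0 < b)
    (hint : Integrable (fun x : ℝ => Real.exp (b * |x|)) F) : Integrable (fun x : ℝ => x) F := by
  refine (hint.const_mul b⁻¹).mono' measurable_id.aestronglyMeasurable (.of_forall fun x => ?_)
  rw [Real.norm_eq_abs, inv_mul_eq_div, le_div_iff₀ hb]
  linarith [Real.add_one_le_exp (b * |x|)]

theorem integral_id_eq_zero {F : Measure ℝ} (hF : F.map (fun x : ℝ => -x) = F) : ∫ x, x ∂F = 0 := by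
  have h : ∫ x, x ∂F = -∫ x, x ∂F := by
    conv_lhs => rw [← hF]
    rw [integral_map (f := fun x : ℝ => x) (by fun_prop) (by fun_prop), integral_neg]
  linarith

theorem integrable_exp_mul_of_abs {F : Measure ℝ} {b s : ℝ} (hs : |s| ≤ b)
    (hint : Integrable (fun x : ℝ => Real.exp (b * |x|)) F) :
    Integrable (fun x : ℝ => Real.exp (s * x)) F := by
  refine hint.mono' (by fun_prop) (.of_forall fun x => ?_)
  rw [Real.norm_eq_abs, Real.abs_exp]
  refine Real.exp_le_exp.2 ?_
  calc s * x ≤ |s * x| := le_abs_self _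
    _ = |s| * |x| := abs_mul _ _
    _ ≤ b * |x| := by gcongr

/-- The moment generating function of a symmetric law is at most Gaussian near `0`. -/
theorem exists_integral_exp_le_sq (hF : F.map (fun x : ℝ => -x) = F) {b : ℝ} (hb : 0 < b)
    (hint : Integrable (fun x : ℝ => Real.exp (b * |x|)) F) :
    ∃ C > 0, ∀ s : ℝ, |s| ≤ b / 2 → ∫ x, Real.exp (s * x) ∂F ≤ Real.exp (C * s ^ 2) := by
  -- The linear term of the expansion vanishes because the mean is 0. The factor 8/b² comes from
  -- y²/2 ≤ exp y at y = b|x|/2, the other half of the exponent being spent on exp|sx|.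
  set A : ℝ := 8 / b ^ 2 * ∫ x, Real.exp (b * |x|) ∂F with hA
  have hApos : 0 < A := mul_pos (by positivity) (integral_exp_pos hint)
  refine ⟨A, hApos, fun s hs => ?_⟩
  have hpt (x : ℝ) : Real.exp (s * x) ≤ 1 + s * x + s ^ 2 * (8 / b ^ 2 * Real.exp (b * |x|)) := by
    have h1 := exp_le_one_add_add_sq_mul (s * x)
    have h2 : Real.exp |s * x| ≤ Real.exp (b / 2 * |x|) := by
      rw [abs_mul]; gcongr
    have h3 : x ^ 2 ≤ 8 / b ^ 2 * Real.exp (b / 2 * |x|) := by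
      have h := Real.pow_div_factorial_le_exp (b / 2 * |x|) (by positivity) 2
      rw [div_mul_eq_mul_div, le_div_iff₀ (by positivity)]
      norm_num [mul_pow] at h
      nlinarith
    have h4 : (s * x) ^ 2 * Real.exp |s * x| ≤
        s ^ 2 * (8 / b ^ 2 * Real.exp (b * |x|)) := by
      calc (s * x) ^ 2 * Real.exp |s * x|
          ≤ (s ^ 2 * (8 / b ^ 2 * Real.exp (b / 2 * |x|))) * Real.exp (b / 2 * |x|) := by
            rw [mul_pow]; gcongr
        _ = s ^ 2 * (8 / b ^ 2 * (Real.exp (b / 2 * |x|) * Real.exp (b / 2 * |x|))) := by ring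
        _ = _ := by rw [← Real.exp_add]; congr 3; ring_nf
    linarith
  have hid := integrable_id_of_exp hb hint
  have hi1 : Integrable (fun x : ℝ => 1 + s * x) F := (integrable_const _).add (hid.const_mul s)
  have hi2 : Integrable (fun x : ℝ => s ^ 2 * (8 / b ^ 2 * Real.exp (b * |x|))) F :=
    (hint.const_mul _).const_mul _
  calc ∫ x, Real.exp (s * x) ∂F
      ≤ ∫ x, (1 + s * x + s ^ 2 * (8 / b ^ 2 * Real.exp (b * |x|))) ∂F :=
        integral_mono (integrable_exp_mul_of_abs (by linarith) hint) (hi1.add hi2) hpt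
    _ = 1 + s ^ 2 * A := by
        rw [integral_add hi1 hi2, integral_add (integrable_const _) (hid.const_mul s),
          integral_const_mul, integral_id_eq_zero hF, integral_const_mul, integral_const_mul]
        simp [hA]
    _ ≤ Real.exp (A * s ^ 2) := by linarith [Real.add_one_le_exp (A * s ^ 2)]

/-- Young's inequality for the conjugate exponents α/(α-1) and α, applied to the factors s/κ and
κ|x| with κ^α = b. -/
theorem integrable_exp_abs_and_le {F : Measure ℝ} {α : ℝ} (hα : 1 < α) {b : ℝ} (hb : 0 < b)
    (hint : Integrable (fun x : ℝ => Real.exp (b * |x| ^ α)) F) :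
    ∃ κ > 0, ∀ s : ℝ, 0 ≤ s → Integrable (fun x : ℝ => Real.exp (s * |x|)) F ∧
      ∫ x, Real.exp (s * |x|) ∂F ≤
        Real.exp (κ * s ^ (α / (α - 1))) * ∫ x, Real.exp (b * |x| ^ α) ∂F := by
  set β := α / (α - 1)
  have hconj : β.HolderConjugate α := (Real.HolderConjugate.conjExponent hα).symm
  set κ : ℝ := b ^ (1 / α)
  have hκ : 0 < κ := by positivity
  have hκα : κ ^ α = b := by
    rw [← Real.rpow_mul hb.le, one_div_mul_cancel (by positivity), Real.rpow_one]
  refine ⟨κ⁻¹ ^ β, by positivity, fun s hs => ?_⟩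
  have hpt (x : ℝ) : Real.exp (s * |x|) ≤
      Real.exp (κ⁻¹ ^ β * s ^ β) * Real.exp (b * |x| ^ α) := by
    rw [← Real.exp_add]
    gcongr
    have h := Real.young_inequality_of_nonneg (a := κ⁻¹ * s) (b := κ * |x|) (by positivity)
      (by positivity) hconj
    rw [Real.mul_rpow (by positivity) hs, Real.mul_rpow hκ.le (abs_nonneg x), hκα] at h
    have h1 : κ⁻¹ ^ β * s ^ β / β ≤ κ⁻¹ ^ β * s ^ β :=
      div_le_self (by positivity) hconj.lt.le
    have h2 : b * |x| ^ α / α ≤ b * |x| ^ α := div_le_self (by positivity) hα.le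
    have h3 : κ⁻¹ * s * (κ * |x|) = s * |x| := by field_simp
    linarith
  have hi := hint.const_mul (Real.exp (κ⁻¹ ^ β * s ^ β))
  have hi' : Integrable (fun x : ℝ => Real.exp (s * |x|)) F := by
    refine hi.mono' (by fun_prop) (.of_forall fun x => ?_)
    rw [Real.norm_eq_abs, Real.abs_exp]
    exact hpt x
  refine ⟨hi', ?_⟩
  rw [← integral_const_mul]
  exact integral_mono hi' hi hpt

/-- The moment generating function of a symmetric law in `𝓛_α⁻`, `α > 1`. -/
theorem exists_integral_exp_le_rpow (hF : F.map (fun x : ℝ => -x) = F) {α : ℝ} (hα : 1 < α)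
    (h : F ∈ TailClassMinus α) :
    ∃ C > 0, ∀ s : ℝ, Integrable (fun x : ℝ => Real.exp (s * x)) F ∧
      (|s| ≤ 1 → ∫ x, Real.exp (s * x) ∂F ≤ Real.exp (C * s ^ 2)) ∧
      (1 ≤ |s| → ∫ x, Real.exp (s * x) ∂F ≤ Real.exp (C * |s| ^ (α / (α - 1)))) := by
  obtain ⟨b, hb, hint⟩ := exists_integrable_exp_abs_rpow hF (by linarith) h
  obtain ⟨κ, hκ, hκs⟩ := integrable_exp_abs_and_le hα hb hint
  obtain ⟨C, hC, hCs⟩ := exists_integral_exp_le_sq hF two_pos (hκs 2 zero_le_two).1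
  set A := ∫ x, Real.exp (b * |x| ^ α) ∂F
  have hA : 0 < A := integral_exp_pos hint
  have hint' (s : ℝ) : Integrable (fun x : ℝ => Real.exp (s * x)) F :=
    integrable_exp_mul_of_abs le_rfl (hκs |s| (abs_nonneg s)).1
  -- Since |s|^β ≥ 1 in the second regime, |log A| absorbs the multiplicative constant `A` into the
  -- exponent.
  refine ⟨C + κ + |Real.log A|, by positivity, fun s => ⟨hint' s, fun hs => ?_, fun hs => ?_⟩⟩
  · refine (hCs s (by linarith)).trans ?_
    gcongr
    linarith [abs_nonneg (Real.log A)]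
  · have hβ : 0 < α / (α - 1) := div_pos (by linarith) (by linarith)
    have h1 : 1 ≤ |s| ^ (α / (α - 1)) := Real.one_le_rpow hs hβ.le
    calc ∫ x, Real.exp (s * x) ∂F ≤ ∫ x, Real.exp (|s| * |x|) ∂F := by
          refine integral_mono (hint' s) (hκs |s| (abs_nonneg s)).1 fun x => ?_
          simp only [← abs_mul]
          gcongr
          exact le_abs_self _
      _ ≤ Real.exp (κ * |s| ^ (α / (α - 1))) * A := (hκs |s| (abs_nonneg s)).2
      _ = Real.exp (κ * |s| ^ (α / (α - 1)) + Real.log A) := by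
          rw [Real.exp_add, Real.exp_log hA]
      _ ≤ _ := by
          gcongr
          have h2 := abs_nonneg (Real.log A)
          have h3 := le_abs_self (Real.log A)
          nlinarith

end Noise

/-! ### From the stochastic matrix to a finitely supported step law -/

theorem IsHarnessMatrix.exists_isStepLaw {d : ℕ} {P : (Fin d → ℤ) → (Fin d → ℤ) → ℝ}
    (hP : IsHarnessMatrix P) :
    ∃ S : Finset (Fin d → ℤ), IsStepLaw S (P 0) ∧
      ∀ (i : Fin d → ℤ) (f : (Fin d → ℤ) → ℝ), ∑' j, P i j * f j = ∑ y ∈ S, P 0 y * f (i + y) := by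
  obtain ⟨v, hv⟩ := hP.finite_range
  have hfin : (Function.support (P 0)).Finite := by
    refine (Metric.finite_isBounded_inter_isClosed DiscreteTopology.isDiscrete
      (Metric.isBounded_closedBall (x := (0 : Fin d → ℤ)) (r := v)) isClosed_univ).subset
      fun x hx => ⟨?_, Set.mem_univ x⟩
    rw [mem_closedBall_zero_iff]
    by_contra! h
    exact hx (hv x h)
  have hmem (y : Fin d → ℤ) : y ∈ hfin.toFinset ↔ P 0 y ≠ 0 := by simp
  refine ⟨hfin.toFinset, ⟨fun y hy => ?_, ?_, fun l => ?_, ?_⟩, fun i f => ?_⟩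
  · exact lt_of_le_of_ne (hP.nonneg 0 y) (Ne.symm ((hmem y).1 hy))
  · rw [← (hP.stochastic 0).tsum_eq, tsum_eq_sum fun y hy => ?_]
    simpa [hmem] using hy
  · rw [← (hP.centered l).tsum_eq, tsum_eq_sum fun y hy => ?_]
    · exact Finset.sum_congr rfl fun y _ => mul_comm _ _
    · rw [not_not.1 ((hmem y).not.1 hy), mul_zero]
  · rw [← hP.generates]
    congr 1
    ext y
    simp
  · rw [← (Equiv.addLeft i).tsum_eq, tsum_eq_sum fun y hy => ?_]
    · refine Finset.sum_congr rfl fun y _ => ?_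
      rw [hP.homogeneous i]
      simp
    · rw [hP.homogeneous i, Equiv.coe_addLeft, add_sub_cancel_left,
        not_not.1 ((hmem y).not.1 hy), zero_mul]

/-! ### The wall process: measurability, stationarity and growth of the mean -/

section Canonical

variable {d : ℕ} {P : (Fin d → ℤ) → (Fin d → ℤ) → ℝ} {Ω : Type*}

theorem wallProcess_comp {Ω' : Type*} (ε : ℕ → (Fin d → ℤ) → Ω' → ℝ) (f : Ω → Ω') (n : ℕ)
    (i : Fin d → ℤ) (ω : Ω) :
    wallProcess P (fun m j ω => ε m j (f ω)) n i ω = wallProcess P ε n i (f ω) := by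
  induction n generalizing i with
  | zero => rfl
  | succ n ih => simp only [wallProcess, ih]

section Measurability

variable {ε : ℕ → (Fin d → ℤ) → Ω → ℝ}

theorem wallProcess_nonneg (n : ℕ) (i : Fin d → ℤ) (ω : Ω) : 0 ≤ wallProcess P ε n i ω := by
  cases n with
  | zero => exact le_rfl
  | succ n => exact le_max_right _ _

variable {S : Finset (Fin d → ℤ)}
  (hsum : ∀ (i : Fin d → ℤ) (f : (Fin d → ℤ) → ℝ),
    ∑' j, P i j * f j = ∑ y ∈ S, P 0 y * f (i + y))
include hsum

theorem wallProcess_succ (n : ℕ) (i : Fin d → ℤ) (ω : Ω) :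
    wallProcess P ε (n + 1) i ω =
      max ((∑ y ∈ S, P 0 y * wallProcess P ε n (i + y) ω) + ε (n + 1) i ω) 0 := by
  simp only [wallProcess, hsum]

theorem measurable_wallProcess_of_le {mΩ : MeasurableSpace Ω} (n : ℕ)
    (hm : ∀ m ≤ n, ∀ i, Measurable[mΩ] (ε m i)) (i : Fin d → ℤ) :
    Measurable[mΩ] (wallProcess P ε n i) := by
  induction n generalizing i with
  | zero => exact measurable_const
  | succ n ih =>
    have h := ih fun m hmn => hm m (hmn.trans n.le_succ)
    have he := hm (n + 1) le_rfl i
    have : wallProcess P ε (n + 1) i = fun ω =>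
        max ((∑ y ∈ S, P 0 y * wallProcess P ε n (i + y) ω) + ε (n + 1) i ω) 0 :=
      funext fun ω => wallProcess_succ hsum n i ω
    rw [this]
    fun_prop

theorem wallProcess_shift (a : Fin d → ℤ) (n : ℕ) (i : Fin d → ℤ) (ω : Ω) :
    wallProcess P (fun m j => ε m (a + j)) n i ω = wallProcess P ε n (a + i) ω := by
  induction n generalizing i with
  | zero => rfl
  | succ n ih => simp only [wallProcess_succ hsum, ih, add_assoc]

end Measurability

/-- The coordinate process on `ℕ × ℤ^d → ℝ`. -/
def coordNoise (d : ℕ) (n : ℕ) (i : Fin d → ℤ) (ξ : ℕ × (Fin d → ℤ) → ℝ) : ℝ := ξ (n, i)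

theorem measurable_coordNoise (n : ℕ) (i : Fin d → ℤ) : Measurable (coordNoise d n i) :=
  measurable_pi_apply _

variable [MeasurableSpace Ω] {Pr : Measure Ω} {F : Measure ℝ} {ε : ℕ → (Fin d → ℤ) → Ω → ℝ}

theorem IsNoise.coordNoise [IsProbabilityMeasure F] (hε : IsNoise Pr F ε) :
    IsNoise (Measure.infinitePi fun _ : ℕ × (Fin d → ℤ) => F) F (coordNoise d) where
  hasLaw n i := ⟨(measurable_coordNoise n i).aemeasurable, Measure.infinitePi_map_eval _ (n, i)⟩
  indep := iIndepFun_infinitePi (X := fun _ x => x) fun _ => measurable_id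
  integrable := hε.integrable
  symmetric := hε.symmetric

variable {S : Finset (Fin d → ℤ)}
  (hsum : ∀ (i : Fin d → ℤ) (f : (Fin d → ℤ) → ℝ),
    ∑' j, P i j * f j = ∑ y ∈ S, P 0 y * f (i + y))
include hsum

/-- The noise field has a product law, so the mean height depends on `F` alone. This gives
translation invariance, and lets the noise be assumed measurable rather than almost everywhere
measurable. -/
theorem meanHeight_eq_canonical [IsProbabilityMeasure F] (hε : IsNoise Pr F ε) (n : ℕ) :
    meanHeight Pr P ε n =
      meanHeight (Measure.infinitePi fun _ : ℕ × (Fin d → ℤ) => F) P (coordNoise d) n := by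
  have hae : AEMeasurable (fun ω (q : ℕ × (Fin d → ℤ)) => ε q.1 q.2 ω) Pr :=
    aemeasurable_pi_lambda _ fun q => (hε.hasLaw q.1 q.2).aemeasurable
  have hmap : Pr.map (fun ω (q : ℕ × (Fin d → ℤ)) => ε q.1 q.2 ω) =
      Measure.infinitePi fun _ : ℕ × (Fin d → ℤ) => F := by
    have := hε.indep.isProbabilityMeasure
    rw [(iIndepFun_iff_map_fun_eq_infinitePi_map₀ hae).1 hε.indep]
    congr 1 with q
    rw [(hε.hasLaw q.1 q.2).map_eq]
  have hmeas : Measurable (wallProcess P (coordNoise d) n 0) :=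
    measurable_wallProcess_of_le hsum n (fun m _ i => measurable_coordNoise m i) 0
  rw [meanHeight, meanHeight, ← hmap, integral_map hae hmeas.aestronglyMeasurable]
  exact integral_congr_ae (.of_forall fun ω =>
    wallProcess_comp (coordNoise d) (fun ω (q : ℕ × (Fin d → ℤ)) => ε q.1 q.2 ω) n 0 ω)

theorem integral_wallProcess [IsProbabilityMeasure F] (hε : IsNoise Pr F ε) (n : ℕ)
    (i : Fin d → ℤ) : ∫ ω, wallProcess P ε n i ω ∂Pr = meanHeight Pr P ε n := by
  have hε' : IsNoise Pr F fun m j => ε m (i + j) :=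
    { hasLaw := fun m j => hε.hasLaw m (i + j)
      indep := hε.indep.precomp (g := fun q : ℕ × (Fin d → ℤ) => (q.1, i + q.2)) fun q r h => by
        simpa [Prod.ext_iff] using h
      integrable := hε.integrable
      symmetric := hε.symmetric }
  rw [meanHeight_eq_canonical hsum hε, ← meanHeight_eq_canonical hsum hε', meanHeight]
  simp_rw [wallProcess_shift hsum, add_zero]

theorem integrable_wallProcess [IsProbabilityMeasure Pr] (hε : IsNoise Pr F ε) (n : ℕ)
    (i : Fin d → ℤ) : Integrable (wallProcess P ε n i) Pr := by
  induction n generalizing i with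
  | zero => exact integrable_const 0
  | succ n ih =>
    have h1 : Integrable (ε (n + 1) i) Pr := by
      have := (hε.hasLaw (n + 1) i)
      have h := hε.integrable
      rw [← this.map_eq] at h
      exact h.comp_aemeasurable this.aemeasurable
    have : wallProcess P ε (n + 1) i = fun ω =>
        max ((∑ y ∈ S, P 0 y * wallProcess P ε n (i + y) ω) + ε (n + 1) i ω) 0 :=
      funext fun ω => wallProcess_succ hsum n i ω
    rw [this]
    exact ((integrable_finsetSum _ fun y _ => (ih (i + y)).const_mul _).add h1).pos_part

/-- The mean height grows by at least the mean of the part of the noise cut off by the wall. -/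
theorem meanHeight_succ_ge [IsProbabilityMeasure Pr] (hS : IsStepLaw S (P 0)) (hε : IsNoise Pr F ε)
    (hm : ∀ n i, Measurable (ε n i)) (n : ℕ) :
    meanHeight Pr P ε n + 1 / 2 * F.real (Set.Ioi (2 * meanHeight Pr P ε n + 2)) ≤
      meanHeight Pr P ε (n + 1) := by
  have hF : IsProbabilityMeasure F := (hε.hasLaw 0 0).isProbabilityMeasure_iff.1 inferInstance
  set μ := meanHeight Pr P ε n with hμ
  have hμ0 : 0 ≤ μ := integral_nonneg fun ω => wallProcess_nonneg n 0 ω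
  set X : Ω → ℝ := fun ω => ∑ y ∈ S, P 0 y * wallProcess P ε n (0 + y) ω with hX
  have hXint : Integrable X Pr :=
    integrable_finsetSum _ fun y _ => (integrable_wallProcess hsum hε n (0 + y)).const_mul _
  have hX0 (ω) : 0 ≤ X ω := Finset.sum_nonneg fun y hy =>
    mul_nonneg (hS.pos y hy).le (wallProcess_nonneg n _ ω)
  have hXμ : ∫ ω, X ω ∂Pr = μ := by
    rw [hX, integral_finsetSum _ fun y _ =>
      (integrable_wallProcess hsum hε n (0 + y)).const_mul _]
    simp_rw [integral_const_mul, integral_wallProcess hsum hε, ← Finset.sum_mul, hS.sum_eq_one,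
      one_mul, hμ]
  have hlaw := hε.hasLaw (n + 1) 0
  have hεint : Integrable (ε (n + 1) 0) Pr := by
    have h := hε.integrable
    rw [← hlaw.map_eq] at h
    exact h.comp_aemeasurable hlaw.aemeasurable
  have hε0 : ∫ ω, ε (n + 1) 0 ω ∂Pr = 0 := by
    rw [← integral_id_eq_zero hε.symmetric, ← hlaw.map_eq,
      integral_map (f := fun x : ℝ => x) hlaw.aemeasurable (by fun_prop)]
  -- On A ∩ B the height before truncation is below -1, so the wall contributes at least 1. Markov's
  -- inequality gives A probability at least 1/2, and `B` has the tail probability of `F` by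
  -- symmetry.
  set A : Set Ω := X ⁻¹' Set.Iio (2 * μ + 1)
  set B : Set Ω := ε (n + 1) 0 ⁻¹' Set.Iio (-(2 * μ + 2))
  -- `A` depends only on the noise up to time `n`, and `B` only on the variable at (n + 1, 0).
  have hind : Pr.real (A ∩ B) = Pr.real A * Pr.real B := by
    set m : ℕ × (Fin d → ℤ) → MeasurableSpace Ω := fun q =>
      MeasurableSpace.comap (ε q.1 q.2) inferInstance with hm'
    have h1 := indep_iSup_of_disjoint (m := m) (fun q => (hm q.1 q.2).comap_le) hε.indep.iIndep
      (S := {q | q.1 ≤ n}) (T := {(n + 1, 0)}) (by simp)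
    have hA : MeasurableSet[⨆ q ∈ {q : ℕ × (Fin d → ℤ) | q.1 ≤ n}, m q] A := by
      have hW (i) : Measurable[⨆ q ∈ {q : ℕ × (Fin d → ℤ) | q.1 ≤ n}, m q]
          (wallProcess P ε n i) := by
        refine measurable_wallProcess_of_le hsum n (fun k hk j => ?_) i
        have h2 : m (k, j) ≤ ⨆ q ∈ {q : ℕ × (Fin d → ℤ) | q.1 ≤ n}, m q :=
          le_iSup₂_of_le (k, j) hk le_rfl
        exact (comap_measurable (ε k j)).mono h2 le_rfl
      have : Measurable[⨆ q ∈ {q : ℕ × (Fin d → ℤ) | q.1 ≤ n}, m q] X := by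
        refine Finset.measurable_sum _ fun y _ => ?_
        exact (hW (0 + y)).const_mul _
      exact this measurableSet_Iio
    have hB : MeasurableSet[⨆ q ∈ ({(n + 1, 0)} : Set (ℕ × (Fin d → ℤ))), m q] B := by
      rw [iSup_singleton]
      exact ⟨_, measurableSet_Iio, rfl⟩
    simp only [measureReal_def, ← ENNReal.toReal_mul]
    rw [(Indep_iff _ _ _).1 h1 A B hA hB]
  have hmA : MeasurableSet A := by
    have : Measurable X := Finset.measurable_sum _ fun y _ =>
      (measurable_wallProcess_of_le hsum n (fun m _ i => hm m i) _).const_mul _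
    exact this measurableSet_Iio
  have hmB : MeasurableSet B := hm _ _ measurableSet_Iio
  have hPA : 1 / 2 ≤ Pr.real A := by
    have h1 := mul_meas_ge_le_integral_of_nonneg (.of_forall hX0) hXint (2 * μ + 1)
    rw [hXμ] at h1
    have h2 : Pr.real A = 1 - Pr.real {ω | 2 * μ + 1 ≤ X ω} := by
      rw [← probReal_compl_eq_one_sub₀ ?_]
      · congr 1
        ext ω
        simp [A]
      · have : {ω | 2 * μ + 1 ≤ X ω} = Aᶜ := by ext ω; simp [A]
        rw [this]
        exact hmA.compl.nullMeasurableSet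
    nlinarith [measureReal_nonneg (μ := Pr) (s := {ω | 2 * μ + 1 ≤ X ω})]
  have hPB : Pr.real B = F.real (Set.Ioi (2 * μ + 2)) := by
    have h1 : Pr.real B = F.real (Set.Iio (-(2 * μ + 2))) := by
      conv_rhs => rw [← hlaw.map_eq,
        map_measureReal_apply_of_aemeasurable hlaw.aemeasurable measurableSet_Iio]
    rw [h1]
    conv_lhs => rw [← hε.symmetric, map_measureReal_apply measurable_neg measurableSet_Iio]
    congr 1
    ext x
    simp
  have hind1 : Integrable (fun ω => (A ∩ B).indicator (fun _ => (1 : ℝ)) ω) Pr :=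
    (integrable_const 1).indicator (hmA.inter hmB)
  calc μ + 1 / 2 * F.real (Set.Ioi (2 * μ + 2))
      ≤ μ + Pr.real (A ∩ B) := by
        rw [hind, hPB]; gcongr
    _ = ∫ ω, (X ω + ε (n + 1) 0 ω + (A ∩ B).indicator (fun _ => (1 : ℝ)) ω) ∂Pr := by
        have hadd := integral_add (hXint.add hεint) hind1
        simp only [Pi.add_apply] at hadd
        rw [hadd, integral_add hXint hεint, hXμ, hε0,
          integral_indicator_const _ (hmA.inter hmB)]
        simp
    _ ≤ meanHeight Pr P ε (n + 1) := by
        refine integral_mono ((hXint.add hεint).add hind1)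
          (integrable_wallProcess hsum hε (n + 1) 0) fun ω => ?_
        simp only [wallProcess_succ hsum]
        change X ω + ε (n + 1) 0 ω + _ ≤ max (X ω + ε (n + 1) 0 ω) 0
        by_cases hω : ω ∈ A ∩ B
        · rw [Set.indicator_of_mem hω]
          have h1 : X ω < 2 * μ + 1 := hω.1
          have h2 : ε (n + 1) 0 ω < -(2 * μ + 2) := hω.2
          exact le_max_of_le_right (by linarith)
        · rw [Set.indicator_of_notMem hω, add_zero]
          exact le_max_left _ _

end Canonical

/-! ### The free process and its comparison with the wall process -/

/-- The height process without a wall, started from `0`. -/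
noncomputable def freeHeight {d : ℕ} {Ω : Type*} (S : Finset (Fin d → ℤ)) (p : (Fin d → ℤ) → ℝ)
    (ε : ℕ → (Fin d → ℤ) → Ω → ℝ) (n : ℕ) (i : Fin d → ℤ) (ω : Ω) : ℝ :=
  ∑ k ∈ Finset.range n, ∑' x, walkProb S p k x * ε (n - k) (i + x) ω

/-- The expected number of collisions before time `n` of two independent walks. -/
noncomputable def collisionSum {d : ℕ} (S : Finset (Fin d → ℤ)) (p : (Fin d → ℤ) → ℝ) (n : ℕ) : ℝ :=
  ∑ k ∈ Finset.range n, ∑' x, walkProb S p k x ^ 2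

section Comparison

variable {d : ℕ} {P : (Fin d → ℤ) → (Fin d → ℤ) → ℝ} {Ω : Type*} {S : Finset (Fin d → ℤ)}
  {p : (Fin d → ℤ) → ℝ} {ε : ℕ → (Fin d → ℤ) → Ω → ℝ}

theorem freeHeight_zero (i : Fin d → ℤ) (ω : Ω) : freeHeight S p ε 0 i ω = 0 := by
  simp [freeHeight]

/-- This is the recursion of the wall process with the positive part removed, which makes pathwise
comparison by induction possible. -/
theorem freeHeight_succ (n : ℕ) (i : Fin d → ℤ) (ω : Ω) :
    freeHeight S p ε (n + 1) i ω =
      ∑ y ∈ S, p y * freeHeight S p ε n (i + y) ω + ε (n + 1) i ω := by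
  rw [freeHeight, Finset.sum_range_succ']
  congr 1
  · simp only [freeHeight, Finset.mul_sum (s := Finset.range n), Nat.add_sub_add_right]
    rw [Finset.sum_comm]
    refine Finset.sum_congr rfl fun k _ => ?_
    rw [walkProb_tsum_succ k fun x => ε (n - k) (i + x) ω]
    refine Finset.sum_congr rfl fun y _ => ?_
    simp_rw [add_comm _ y, ← add_assoc, add_comm y i]
  · rw [walkProb_tsum_zero fun x => ε (n + 1 - 0) (i + x) ω]
    simp

theorem exists_walkProb_support (n : ℕ) :
    ∃ B : Finset (Fin d → ℤ), ∀ k < n, ∀ x ∉ B, walkProb S p k x = 0 := by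
  refine ⟨(Finset.range n).biUnion fun k => (walkProb_finite_support (S := S) (p := p) k).toFinset,
    fun k hk x hx => ?_⟩
  by_contra h
  exact hx (Finset.mem_biUnion.2 ⟨k, Finset.mem_range.2 hk, by simpa using h⟩)

theorem freeHeight_eq_sum {n : ℕ} {B : Finset (Fin d → ℤ)}
    (hB : ∀ k < n, ∀ x ∉ B, walkProb S p k x = 0) (i : Fin d → ℤ) (ω : Ω) :
    freeHeight S p ε n i ω = ∑ z ∈ (Finset.univ : Finset (Fin n)) ×ˢ B,
      walkProb S p z.1 z.2 * ε (n - z.1) (i + z.2) ω := by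
  rw [freeHeight, Finset.sum_range, Finset.sum_product]
  refine Finset.sum_congr rfl fun k _ => tsum_eq_sum fun x hx => ?_
  rw [hB k k.2 x hx, zero_mul]

theorem collisionSum_eq_sum {n : ℕ} {B : Finset (Fin d → ℤ)}
    (hB : ∀ k < n, ∀ x ∉ B, walkProb S p k x = 0) :
    collisionSum S p n = ∑ z ∈ (Finset.univ : Finset (Fin n)) ×ˢ B, walkProb S p z.1 z.2 ^ 2 := by
  rw [collisionSum, Finset.sum_range, Finset.sum_product]
  refine Finset.sum_congr rfl fun k _ => tsum_eq_sum fun x hx => ?_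
  rw [hB k k.2 x hx, zero_pow two_ne_zero]

variable (hsum : ∀ (i : Fin d → ℤ) (f : (Fin d → ℤ) → ℝ),
    ∑' j, P i j * f j = ∑ y ∈ S, P 0 y * f (i + y))
include hsum

theorem freeHeight_le_wallProcess (hS : IsStepLaw S (P 0)) (n : ℕ) (i : Fin d → ℤ) (ω : Ω) :
    freeHeight S (P 0) ε n i ω ≤ wallProcess P ε n i ω := by
  induction n generalizing i with
  | zero => rw [freeHeight_zero]; exact le_rfl
  | succ n ih =>
    rw [freeHeight_succ, wallProcess_succ hsum]
    refine le_max_of_le_left ?_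
    gcongr with y hy
    · exact (hS.pos y hy).le
    · exact ih _

/-- The wall lifts the free process at most by the depth of its lowest past position in the
cone of influence. -/
theorem wallProcess_le_freeHeight_add (hS : IsStepLaw S (P 0)) {R : ℕ}
    (hR : ∀ y ∈ S, ∀ l, |y l| ≤ R) (n : ℕ) (ω : Ω) {M : ℝ}
    (hM : ∀ k ≤ n, ∀ i : Fin d → ℤ, (∀ l, |i l| ≤ R * n) → -freeHeight S (P 0) ε k i ω ≤ M)
    (k : ℕ) (hk : k ≤ n) (i : Fin d → ℤ) (hi : ∀ l, |i l| + R * k ≤ R * n) :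
    wallProcess P ε k i ω ≤ freeHeight S (P 0) ε k i ω + M := by
  induction k generalizing i with
  | zero =>
    have := hM 0 hk i fun l => by simpa using hi l
    rw [freeHeight_zero] at this ⊢
    simp only [wallProcess]
    linarith
  | succ k ih =>
    have h0 := hM (k + 1) hk i fun l => by
      have := hi l
      have h2 : (0 : ℤ) ≤ R * ((k + 1 : ℕ) : ℤ) := by positivity
      linarith
    rw [wallProcess_succ hsum]
    -- Where the wall acts, the height is 0, which is at most V + M by the choice of `M`. Elsewhere
    -- averaging carries the constant `M` along, and the range `R` of a step keeps the neighbours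
    -- inside the cone.
    refine max_le ?_ (by linarith)
    rw [freeHeight_succ]
    have h1 : ∑ y ∈ S, P 0 y * wallProcess P ε k (i + y) ω ≤
        ∑ y ∈ S, P 0 y * (freeHeight S (P 0) ε k (i + y) ω + M) := by
      refine Finset.sum_le_sum fun y hy => mul_le_mul_of_nonneg_left ?_ (hS.pos y hy).le
      refine ih (by omega) (i + y) fun l => ?_
      have h1 := hi l
      have h2 := hR y hy l
      have h3 := abs_add_le (i l) (y l)
      push_cast at h1
      rw [Pi.add_apply]
      linarith
    simp_rw [mul_add, Finset.sum_add_distrib, ← Finset.sum_mul, hS.sum_eq_one, one_mul] at h1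
    linarith

end Comparison

/-! ### Moments of the free process and the resulting bounds on the mean height -/

section Moments

variable {d : ℕ} {P : (Fin d → ℤ) → (Fin d → ℤ) → ℝ} {Ω : Type*} [MeasurableSpace Ω]
  {Pr : Measure Ω} {F : Measure ℝ} {S : Finset (Fin d → ℤ)}
  {p : (Fin d → ℤ) → ℝ} {ε : ℕ → (Fin d → ℤ) → Ω → ℝ}

/-- Different pairs (k, x) read different noise variables; the truncated subtraction n - k is
injective because k < n. -/
theorem IsNoise.iIndepFun_walk (hε : IsNoise Pr F ε) (n : ℕ) (i : Fin d → ℤ) :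
    iIndepFun (fun (z : Fin n × (Fin d → ℤ)) ω => walkProb S p z.1 z.2 *
      ε (n - z.1) (i + z.2) ω) Pr := by
  have h1 := hε.indep.precomp (g := fun z : Fin n × (Fin d → ℤ) => (n - (z.1 : ℕ), i + z.2))
    fun z w h => by
      simp only [Prod.mk.injEq, add_right_inj] at h
      refine Prod.ext (Fin.ext ?_) h.2
      have := z.1.2
      have := w.1.2
      omega
  exact h1.comp (fun z x => walkProb S p z.1 z.2 * x) fun z => measurable_const_mul _

theorem integrable_freeHeight (hε : IsNoise Pr F ε) (n : ℕ) (i : Fin d → ℤ) :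
    Integrable (freeHeight S p ε n i) Pr ∧ ∫ ω, freeHeight S p ε n i ω ∂Pr = 0 := by
  obtain ⟨B, hB⟩ := exists_walkProb_support (S := S) (p := p) n
  have h1 (m j) : Integrable (ε m j) Pr ∧ ∫ ω, ε m j ω ∂Pr = 0 := by
    have hlaw := hε.hasLaw m j
    have h := hε.integrable
    rw [← hlaw.map_eq] at h
    refine ⟨h.comp_aemeasurable hlaw.aemeasurable, ?_⟩
    rw [← integral_id_eq_zero hε.symmetric, ← hlaw.map_eq,
      integral_map (f := fun x : ℝ => x) hlaw.aemeasurable (by fun_prop)]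
  have h2 : freeHeight S p ε n i = fun ω => ∑ z ∈ (Finset.univ : Finset (Fin n)) ×ˢ B,
      walkProb S p z.1 z.2 * ε (n - z.1) (i + z.2) ω := funext fun ω => freeHeight_eq_sum hB i ω
  rw [h2]
  refine ⟨integrable_finsetSum _ fun z _ => (h1 _ _).1.const_mul _, ?_⟩
  rw [integral_finsetSum _ fun z _ => (h1 _ _).1.const_mul _]
  exact Finset.sum_eq_zero fun z _ => by rw [integral_const_mul, (h1 _ _).2, mul_zero]

theorem variance_freeHeight (hε : IsNoise Pr F ε) (hF : MemLp (fun x : ℝ => x) 2 F) (n : ℕ)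
    (i : Fin d → ℤ) : MemLp (freeHeight S p ε n i) 2 Pr ∧
      ∫ ω, freeHeight S p ε n i ω ^ 2 ∂Pr = (∫ x, x ^ 2 ∂F) * collisionSum S p n := by
  obtain ⟨B, hB⟩ := exists_walkProb_support (S := S) (p := p) n
  set X : Fin n × (Fin d → ℤ) → Ω → ℝ := fun z ω =>
    walkProb S p z.1 z.2 * ε (n - z.1) (i + z.2) ω with hX
  have hV : freeHeight S p ε n i = ∑ z ∈ (Finset.univ : Finset (Fin n)) ×ˢ B, X z := by
    ext ω
    rw [freeHeight_eq_sum hB, Finset.sum_apply]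
  have hmem (m j) : MemLp (ε m j) 2 Pr := by
    have hlaw := hε.hasLaw m j
    rw [← hlaw.map_eq] at hF
    exact hF.comp_of_map hlaw.aemeasurable
  have hXmem (z) : MemLp (X z) 2 Pr := (hmem _ _).const_mul _
  have hsq (m j) : Var[ε m j; Pr] = ∫ x, x ^ 2 ∂F := by
    have hlaw := hε.hasLaw m j
    have h0 : ∫ ω, ε m j ω ∂Pr = 0 := by
      rw [← integral_id_eq_zero hε.symmetric, ← hlaw.map_eq,
        integral_map (f := fun x : ℝ => x) hlaw.aemeasurable (by fun_prop)]
    rw [variance_of_integral_eq_zero hlaw.aemeasurable h0, ← hlaw.map_eq,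
      integral_map hlaw.aemeasurable (by fun_prop)]
  have hvar : Var[freeHeight S p ε n i; Pr] = (∫ x, x ^ 2 ∂F) * collisionSum S p n := by
    have hind : iIndepFun X Pr := hε.iIndepFun_walk n i
    rw [hV, IndepFun.variance_sum (fun z _ => hXmem z) fun z _ w _ hzw => hind.indepFun hzw,
      collisionSum_eq_sum hB, Finset.mul_sum]
    refine Finset.sum_congr rfl fun z _ => ?_
    rw [hX, variance_const_mul, hsq, mul_comm]
  have hfree : MemLp (freeHeight S p ε n i) 2 Pr := by
    rw [hV]; exact memLp_finsetSum' _ fun z _ => hXmem z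
  refine ⟨hfree, ?_⟩
  rw [← hvar, variance_of_integral_eq_zero hfree.aemeasurable (integrable_freeHeight hε n i).2]

variable [IsProbabilityMeasure Pr]

/-- Exponential moments of the free process. -/
theorem integrable_exp_freeHeight (hS : IsStepLaw S p) (hε : IsNoise Pr F ε)
    (hm : ∀ n i, Measurable (ε n i)) {t : ℝ} {L : ℝ → ℝ}
    (hL : ∀ y, 0 ≤ y → y ≤ 1 → Integrable (fun x => Real.exp (t * y * x)) F ∧
      ∫ x, Real.exp (t * y * x) ∂F ≤ Real.exp (L y))
    {a : ℕ → ℝ} (ha : ∀ k (B : Finset (Fin d → ℤ)), ∑ x ∈ B, L (walkProb S p k x) ≤ a k)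
    (n : ℕ) (i : Fin d → ℤ) :
    Integrable (fun ω => Real.exp (t * freeHeight S p ε n i ω)) Pr ∧
      ∫ ω, Real.exp (t * freeHeight S p ε n i ω) ∂Pr ≤
        Real.exp (∑ k ∈ Finset.range n, a k) := by
  obtain ⟨B, hB⟩ := exists_walkProb_support (S := S) (p := p) n
  set X : Fin n × (Fin d → ℤ) → Ω → ℝ := fun z ω =>
    walkProb S p z.1 z.2 * ε (n - z.1) (i + z.2) ω with hX
  have hV (ω) : freeHeight S p ε n i ω =
      (∑ z ∈ (Finset.univ : Finset (Fin n)) ×ˢ B, X z) ω := by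
    rw [freeHeight_eq_sum hB, Finset.sum_apply]
  have hXm (z) : Measurable (X z) := (hm _ _).const_mul _
  have hone (z) : Integrable (fun ω => Real.exp (t * X z ω)) Pr ∧
      mgf (X z) Pr t ≤ Real.exp (L (walkProb S p z.1 z.2)) := by
    obtain ⟨h1, h2⟩ := hL _ (hS.walkProb_nonneg z.1 z.2) (hS.walkProb_le_one z.1 z.2)
    have hlaw := hε.hasLaw (n - z.1) (i + z.2)
    rw [← hlaw.map_eq] at h1 h2
    rw [integral_map hlaw.aemeasurable (by fun_prop)] at h2
    have h3 := h1.comp_aemeasurable hlaw.aemeasurable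
    simp only [hX, mgf, ← mul_assoc]
    exact ⟨h3, h2⟩
  have hind : iIndepFun X Pr := hε.iIndepFun_walk n i
  simp_rw [hV]
  refine ⟨hind.integrable_exp_mul_sum hXm fun z _ => (hone z).1, ?_⟩
  have hmgf := hind.mgf_sum (t := t) hXm ((Finset.univ : Finset (Fin n)) ×ˢ B)
  rw [mgf] at hmgf
  rw [hmgf]
  calc ∏ z ∈ (Finset.univ : Finset (Fin n)) ×ˢ B, mgf (X z) Pr t
      ≤ ∏ z ∈ (Finset.univ : Finset (Fin n)) ×ˢ B, Real.exp (L (walkProb S p z.1 z.2)) :=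
        Finset.prod_le_prod (fun z _ => mgf_nonneg) fun z _ => (hone z).2
    _ = Real.exp (∑ k : Fin n, ∑ x ∈ B, L (walkProb S p k x)) := by
        rw [← Real.exp_sum, Finset.sum_product]
    _ ≤ Real.exp (∑ k ∈ Finset.range n, a k) := by
        rw [Finset.sum_range]
        gcongr with k
        exact ha k B

theorem integrable_exp_freeHeight_of_sq (hS : IsStepLaw S p) (hε : IsNoise Pr F ε)
    (hm : ∀ n i, Measurable (ε n i)) {b C : ℝ} (hC : 0 ≤ C)
    (hint : Integrable (fun x : ℝ => Real.exp (b * |x|)) F)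
    (hCs : ∀ s : ℝ, |s| ≤ b / 2 → ∫ x, Real.exp (s * x) ∂F ≤ Real.exp (C * s ^ 2))
    {t : ℝ} (ht : |t| ≤ b / 2) (n : ℕ) (i : Fin d → ℤ) :
    Integrable (fun ω => Real.exp (t * freeHeight S p ε n i ω)) Pr ∧
      ∫ ω, Real.exp (t * freeHeight S p ε n i ω) ∂Pr ≤
        Real.exp (C * t ^ 2 * collisionSum S p n) := by
  rw [collisionSum, Finset.mul_sum]
  refine integrable_exp_freeHeight hS hε hm (L := fun y => C * t ^ 2 * y ^ 2) (fun y hy0 hy1 => ?_)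
    (fun k B => ?_) n i
  · have h1 : |t * y| ≤ |t| := by
      rw [abs_mul, abs_of_nonneg hy0]
      exact mul_le_of_le_one_right (abs_nonneg t) hy1
    refine ⟨integrable_exp_mul_of_abs (by linarith [abs_nonneg t]) hint,
      (hCs (t * y) (by linarith)).trans_eq ?_⟩
    congr 1
    ring
  · rw [← Finset.mul_sum]
    gcongr
    exact (walkProb_sq_summable k).sum_le_tsum B fun x _ => sq_nonneg _

/-- Two walks from the same point always collide at time 0. -/
theorem one_le_collisionSum (n : ℕ) (hn : n ≠ 0) : 1 ≤ collisionSum S p n := by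
  have h0 (k : ℕ) : 0 ≤ ∑' x, walkProb S p k x ^ 2 := tsum_nonneg fun x => sq_nonneg _
  have h1 : ∑' x, walkProb S p 0 x ^ 2 = 1 := by
    simp_rw [sq]
    rw [walkProb_tsum_zero]
    simp [walkProb]
  rw [← h1]
  exact Finset.single_le_sum (f := fun k => ∑' x, walkProb S p k x ^ 2) (fun k _ => h0 k)
    (Finset.mem_range.2 (Nat.pos_of_ne_zero hn))

variable (hsum : ∀ (i : Fin d → ℤ) (f : (Fin d → ℤ) → ℝ),
    ∑' j, P i j * f j = ∑ y ∈ S, P 0 y * f (i + y))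
include hsum

/-- A union bound for the mean height in terms of exponential moments of the free process. -/
theorem meanHeight_le_of_exp_moment (hS : IsStepLaw S (P 0)) (hε : IsNoise Pr F ε) {R : ℕ}
    (hR : ∀ y ∈ S, ∀ l, |y l| ≤ R) {n : ℕ} {t A : ℝ} (ht : 0 < t)
    (h : ∀ k ≤ n, ∀ i, Integrable (fun ω => Real.exp (-t * freeHeight S (P 0) ε k i ω)) Pr ∧
      ∫ ω, Real.exp (-t * freeHeight S (P 0) ε k i ω) ∂Pr ≤ Real.exp A) :
    meanHeight Pr P ε n ≤ (Real.log ((n + 1) * (2 * (R * n) + 1) ^ d) + A) / t := by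
  set J : Finset (ℕ × (Fin d → ℤ)) := Finset.range (n + 1) ×ˢ
    Finset.Icc (fun _ => -((R : ℤ) * n)) (fun _ => (R : ℤ) * n) with hJ
  have hcard : (J.card : ℝ) = (n + 1) * (2 * (R * n) + 1) ^ d := by
    rw [hJ, Finset.card_product, Pi.card_Icc]
    simp only [Int.card_Icc, Finset.prod_const, Finset.card_univ, Fintype.card_fin,
      Finset.card_range]
    rw [show ((R : ℤ) * n + 1 - -((R : ℤ) * n)).toNat = 2 * (R * n) + 1 by
      rw [← Nat.cast_mul]; omega]
    push_cast
    rfl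
  set N : ℝ := (n + 1) * (2 * (R * n) + 1) ^ d with hN
  have hN0 : 0 < N := by positivity
  -- An upper bound for the mean of `T`, the sum of exp(-tV) over the cone.
  set a : ℝ := N * Real.exp A
  have ha : 0 < a := by positivity
  have hloga : Real.log a = Real.log N + A := by
    rw [Real.log_mul hN0.ne' (Real.exp_pos _).ne', Real.log_exp]
  set T : Ω → ℝ := fun ω => ∑ z ∈ J, Real.exp (-t * freeHeight S (P 0) ε z.1 z.2 ω)
  have hJle (z) (hz : z ∈ J) : z.1 ≤ n := by
    have := Finset.mem_range.1 (Finset.mem_product.1 hz).1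
    omega
  have hTint : Integrable T Pr := integrable_finsetSum _ fun z hz => (h z.1 (hJle z hz) z.2).1
  have hTle : ∫ ω, T ω ∂Pr ≤ a := by
    rw [integral_finsetSum _ fun z hz => (h z.1 (hJle z hz) z.2).1]
    refine (Finset.sum_le_card_nsmul J _ (Real.exp A) fun z hz => (h z.1 (hJle z hz) z.2).2).trans ?_
    rw [nsmul_eq_mul, hcard]
  -- The tangent to the logarithm at `a` gives -tV ≤ log a - 1 + T/a throughout the cone. The
  -- maximum is thus bounded by an affine function of `T`, and only the mean of `T` is needed.
  have hle (ω : Ω) : wallProcess P ε n 0 ω ≤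
      freeHeight S (P 0) ε n 0 ω + (T ω / a + (Real.log a - 1)) / t := by
    refine wallProcess_le_freeHeight_add hsum hS hR n ω (fun k hk i hi => ?_) n le_rfl 0
      (by simp)
    have hmem : (k, i) ∈ J := by
      refine Finset.mem_product.2 ⟨Finset.mem_range.2 (by simp; omega), Finset.mem_Icc.2
        ⟨fun l => (abs_le.1 (hi l)).1, fun l => (abs_le.1 (hi l)).2⟩⟩
    have h1 := Finset.single_le_sum
      (f := fun z : ℕ × (Fin d → ℤ) => Real.exp (-t * freeHeight S (P 0) ε z.1 z.2 ω))
      (fun z _ => (Real.exp_pos _).le) hmem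
    have h2 := Real.add_one_le_exp (-t * freeHeight S (P 0) ε k i ω - Real.log a)
    rw [Real.exp_sub, Real.exp_log ha] at h2
    have h3 : Real.exp (-t * freeHeight S (P 0) ε k i ω) / a ≤ T ω / a := by
      gcongr
    rw [le_div_iff₀ ht]
    linarith
  obtain ⟨hVint, hV0⟩ := integrable_freeHeight (S := S) (p := P 0) hε n 0
  have hMint : Integrable (fun ω => (T ω / a + (Real.log a - 1)) / t) Pr :=
    ((hTint.div_const a).add (integrable_const _)).div_const t
  calc meanHeight Pr P ε n
      ≤ ∫ ω, (freeHeight S (P 0) ε n 0 ω + (T ω / a + (Real.log a - 1)) / t) ∂Pr :=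
        integral_mono (integrable_wallProcess hsum hε n 0) (hVint.add hMint) hle
    _ = ((∫ ω, T ω ∂Pr) / a + (Real.log a - 1)) / t := by
        rw [integral_add hVint hMint, hV0, integral_div, integral_add (hTint.div_const a)
          (integrable_const _), integral_div, integral_const]
        simp
    _ ≤ (1 + (Real.log a - 1)) / t := by
        gcongr
        exact (div_le_one ha).2 hTle
    _ = (Real.log N + A) / t := by rw [hloga]; ring

/-- The mean height is at least of the order of the standard deviation of the free process. -/
theorem exists_sqrt_collisionSum_le_meanHeight (hS : IsStepLaw S (P 0)) (hε : IsNoise Pr F ε)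
    (hm : ∀ n i, Measurable (ε n i)) (hF : F ∈ TailClassMinus 1) (hF0 : F ≠ Measure.dirac 0) :
    ∃ c > 0, ∀ n, c * √(collisionSum S (P 0) n) ≤ meanHeight Pr P ε n := by
  have hFp : IsProbabilityMeasure F := (hε.hasLaw 0 0).isProbabilityMeasure_iff.1 inferInstance
  obtain ⟨b, hb, hint⟩ := exists_integrable_exp_abs_rpow hε.symmetric one_pos hF
  simp only [Real.rpow_one] at hint
  obtain ⟨C, hC, hCs⟩ := exists_integral_exp_le_sq hε.symmetric hb hint
  have hFL2 : MemLp (fun x : ℝ => x) 2 F := by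
    refine (memLp_two_iff_integrable_sq (by fun_prop)).2 ((hint.const_mul (2 / b ^ 2)).mono'
      (by fun_prop) (.of_forall fun x => ?_))
    have h := Real.pow_div_factorial_le_exp (b * |x|) (by positivity) 2
    norm_num [mul_pow] at h
    rw [Real.norm_eq_abs, abs_of_nonneg (sq_nonneg x), div_mul_eq_mul_div,
      le_div_iff₀ (by positivity)]
    linarith
  set v := ∫ x, x ^ 2 ∂F with hv
  have hv0 : 0 < v := by
    refine lt_of_le_of_ne (integral_nonneg fun x => sq_nonneg x) fun h => hF0 ?_
    have h1 := (integral_eq_zero_iff_of_nonneg (fun x => sq_nonneg x)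
      ((memLp_two_iff_integrable_sq (by fun_prop)).1 hFL2)).1 h.symm
    have h2 : (fun x : ℝ => x) =ᵐ[F] fun _ => 0 := by
      filter_upwards [h1] with x hx
      simpa using hx
    calc F = F.map fun x => x := Measure.map_id.symm
      _ = F.map fun _ => 0 := Measure.map_congr h2
      _ = Measure.dirac 0 := by rw [Measure.map_const]; simp
  -- The fourth moment is at most K r⁴. Here 48 is twice 4!, from y⁴/4! ≤ exp y and the two signs of
  -- the exponent.
  set K : ℝ := 48 / (b / 2) ^ 4 * Real.exp (C * (b / 2) ^ 2) with hKdef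
  have hK : 0 < K := by positivity
  -- With q = Λr, this makes the fourth-moment term exactly half of the second-moment term, leaving
  -- v r/(4Λ).
  set Λ : ℝ := √(2 * K / v)
  have hΛ : 0 < Λ := by positivity
  have hΛ2 : Λ ^ 2 = 2 * K / v := Real.sq_sqrt (by positivity)
  refine ⟨v / (4 * Λ), by positivity, fun n => ?_⟩
  rcases eq_or_ne n 0 with rfl | hn
  · simp [collisionSum, meanHeight, wallProcess]
  have hs1 : 1 ≤ collisionSum S (P 0) n := one_le_collisionSum n hn
  set r := √(collisionSum S (P 0) n)
  have hr1 : 1 ≤ r := Real.one_le_sqrt.2 hs1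
  have hr2 : r ^ 2 = collisionSum S (P 0) n := Real.sq_sqrt (by linarith)
  set V := freeHeight S (P 0) ε n 0
  obtain ⟨hVint, hV0⟩ : Integrable V Pr ∧ ∫ ω, V ω ∂Pr = 0 := integrable_freeHeight hε n 0
  obtain ⟨hVL2, hV2⟩ := variance_freeHeight (S := S) (p := P 0) hε hFL2 n 0
  rw [← hv, ← hr2] at hV2
  -- At this scale t² times the collision number is constant, so the exponential moments are bounded
  -- uniformly in `n`; r ≥ 1 keeps `t` in the admissible range.
  set t : ℝ := b / 2 / r with htdef
  have ht : 0 < t := by positivity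
  have htb : t ≤ b / 2 := div_le_self (by positivity) hr1
  have hmom (u : ℝ) (hu : |u| = t) : Integrable (fun ω => Real.exp (u * V ω)) Pr ∧
      ∫ ω, Real.exp (u * V ω) ∂Pr ≤ Real.exp (C * (b / 2) ^ 2) := by
    have h := integrable_exp_freeHeight_of_sq hS hε hm hC.le hint hCs
      (hu.trans_le htb) n 0
    refine ⟨h.1, h.2.trans_eq ?_⟩
    rw [← sq_abs u, hu, ← hr2, htdef]
    congr 1
    field_simp
  obtain ⟨hp1, hp2⟩ := hmom t (abs_of_pos ht)
  obtain ⟨hn1, hn2⟩ := hmom (-t) (by rw [abs_neg, abs_of_pos ht])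
  have h4pt (ω) : V ω ^ 4 ≤ 24 / t ^ 4 * (Real.exp (t * V ω) + Real.exp (-t * V ω)) := by
    have h := Real.pow_div_factorial_le_exp (t * |V ω|) (by positivity) 4
    norm_num [mul_pow, Nat.factorial] at h
    have h2 : Real.exp (t * |V ω|) ≤ Real.exp (t * V ω) + Real.exp (-t * V ω) := by
      rcases abs_cases (V ω) with ⟨h, _⟩ | ⟨h, _⟩ <;> rw [h]
      · linarith [Real.exp_pos (-t * V ω)]
      · rw [mul_neg, ← neg_mul]; linarith [Real.exp_pos (t * V ω)]
    have h3 : |V ω| ^ 4 = V ω ^ 4 := by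
      rw [show 4 = 2 * 2 by norm_num, pow_mul, sq_abs, ← pow_mul]
    rw [h3] at h
    rw [div_mul_eq_mul_div, le_div_iff₀ (by positivity)]
    linarith
  have h4dom : Integrable (fun ω => 24 / t ^ 4 * (Real.exp (t * V ω) + Real.exp (-t * V ω))) Pr :=
    (hp1.add hn1).const_mul _
  have h4int : Integrable (fun ω => V ω ^ 4) Pr := by
    refine h4dom.mono' (hVint.1.pow 4) (.of_forall fun ω => ?_)
    rw [Real.norm_eq_abs, abs_of_nonneg (by positivity)]
    exact h4pt ω
  have h4 : ∫ ω, V ω ^ 4 ∂Pr ≤ K * r ^ 4 := by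
    calc ∫ ω, V ω ^ 4 ∂Pr ≤ _ := integral_mono h4int h4dom h4pt
      _ = 24 / t ^ 4 * (∫ ω, Real.exp (t * V ω) ∂Pr + ∫ ω, Real.exp (-t * V ω) ∂Pr) := by
        rw [integral_const_mul, integral_add hp1 hn1]
      _ ≤ 24 / t ^ 4 * (Real.exp (C * (b / 2) ^ 2) + Real.exp (C * (b / 2) ^ 2)) := by gcongr
      _ = K * r ^ 4 := by rw [htdef, hKdef]; field_simp; ring
  have hsqint : Integrable (fun ω => V ω ^ 2) Pr := hVL2.integrable_sq
  set q : ℝ := Λ * r with hq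
  have hqpos : 0 < q := by positivity
  -- Here V⁺ = (V + |V|)/2 ≤ W, and |V| ≥ V²/q - V⁴/q³ because y² - y⁴ ≤ y for y ≥ 0. After
  -- integration only the second and fourth moments remain.
  have hpt (ω) : V ω / 2 + (V ω ^ 2 / (2 * q) - V ω ^ 4 / (2 * q ^ 3)) ≤ wallProcess P ε n 0 ω := by
    have h1 : V ω ^ 2 / q - V ω ^ 4 / q ^ 3 ≤ |V ω| := by
      set y := |V ω| / q
      have hy : 0 ≤ y := by positivity
      have hyV : |V ω| = y * q := by simp only [y]; field_simp
      have e2 : V ω ^ 2 = (y * q) ^ 2 := by rw [← hyV, sq_abs]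
      have e4 : V ω ^ 4 = (y * q) ^ 4 := by
        rw [show 4 = 2 * 2 by norm_num, pow_mul, e2, ← pow_mul]
      rw [e2, e4, hyV, show (y * q) ^ 2 / q - (y * q) ^ 4 / q ^ 3 = (y ^ 2 - y ^ 4) * q by
        field_simp]
      refine mul_le_mul_of_nonneg_right ?_ hqpos.le
      rcases le_total y 1 with h | h
      · nlinarith [pow_nonneg hy 4]
      · nlinarith [pow_le_pow_right₀ h (show 2 ≤ 4 by norm_num)]
    have h2 : V ω / 2 + |V ω| / 2 ≤ wallProcess P ε n 0 ω := by
      rcases abs_cases (V ω) with ⟨h, _⟩ | ⟨h, _⟩ <;> rw [h]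
      · linarith [freeHeight_le_wallProcess hsum hS (ε := ε) n 0 ω]
      · linarith [wallProcess_nonneg (P := P) (ε := ε) n 0 ω]
    have h3 : V ω ^ 2 / (2 * q) - V ω ^ 4 / (2 * q ^ 3) =
      (V ω ^ 2 / q - V ω ^ 4 / q ^ 3) / 2 := by field_simp
    linarith
  have hi1 := hVint.div_const 2
  have hi2 := hsqint.div_const (2 * q)
  have hi4 := h4int.div_const (2 * q ^ 3)
  calc v / (4 * Λ) * r = v * r ^ 2 / (2 * q) - K * r ^ 4 / (2 * q ^ 3) := by
        have hKv : K = Λ ^ 2 * v / 2 := by rw [hΛ2]; field_simp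
        rw [hKv, hq]
        field_simp
        ring
    _ ≤ v * r ^ 2 / (2 * q) - (∫ ω, V ω ^ 4 ∂Pr) / (2 * q ^ 3) := by gcongr
    _ = ∫ ω, (V ω / 2 + (V ω ^ 2 / (2 * q) - V ω ^ 4 / (2 * q ^ 3))) ∂Pr := by
        have e1 := integral_add hi1 (hi2.sub hi4)
        simp only [Pi.sub_apply] at e1
        rw [e1, integral_sub hi2 hi4, integral_div, integral_div, integral_div, hV0, hV2]
        simp
    _ ≤ meanHeight Pr P ε n :=
        integral_mono (hi1.add (hi2.sub hi4)) (integrable_wallProcess hsum hε n 0) hpt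

end Moments

/-! ### Sums of powers -/

section PowerSums

theorem sum_range_rpow_neg_le {θ : ℝ} (hθ0 : 0 ≤ θ) (hθ : θ < 1) (m : ℕ) :
    ∑ k ∈ Finset.range m, ((k : ℝ) + 1) ^ (-θ) ≤ (m : ℝ) ^ (1 - θ) / (1 - θ) := by
  have h1 : 0 < 1 - θ := by linarith
  induction m with
  | zero => simp [Real.zero_rpow h1.ne']
  | succ m ih =>
    rw [Finset.sum_range_succ]
    have hm : (0 : ℝ) < (m : ℝ) + 1 := by positivity
    have h2 := rpow_one_add_le_one_add_mul_self (s := -(1 / ((m : ℝ) + 1)))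
      (by rw [neg_le_neg_iff, div_le_one hm]; linarith [m.cast_nonneg (α := ℝ)])
      -- Bernoulli's inequality for the concave power 1 - θ bounds each term by an increment of
      -- m^{1-θ}/(1-θ).
      h1.le (by linarith : 1 - θ ≤ 1)
    rw [show 1 + -(1 / ((m : ℝ) + 1)) = m / ((m : ℝ) + 1) by field_simp; ring,
      Real.div_rpow (by positivity) hm.le, div_le_iff₀ (by positivity)] at h2
    have h3 : ((m : ℝ) + 1) ^ (1 - θ) = ((m : ℝ) + 1) * ((m : ℝ) + 1) ^ (-θ) := by
      rw [sub_eq_add_neg, Real.rpow_add hm, Real.rpow_one]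
    rw [h3] at h2
    push_cast
    rw [h3]
    have h4 : (1 + (1 - θ) * -(1 / ((m : ℝ) + 1))) * (((m : ℝ) + 1) * ((m : ℝ) + 1) ^ (-θ)) =
      ((m : ℝ) + 1) * ((m : ℝ) + 1) ^ (-θ) - (1 - θ) * ((m : ℝ) + 1) ^ (-θ) := by
      field_simp
      ring
    rw [h4] at h2
    rw [le_div_iff₀ h1] at ih ⊢
    nlinarith

theorem sum_range_add_rpow_neg_le {ρ : ℝ} (hρ : 1 < ρ) {m : ℕ} (hm : 0 < m) (n : ℕ) :
    ∑ k ∈ Finset.range n, ((m : ℝ) + k + 1) ^ (-ρ) ≤ (m : ℝ) ^ (1 - ρ) / (ρ - 1) := by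
  have h1 : 0 < ρ - 1 := by linarith
  have hm' : (0 : ℝ) < m := by exact_mod_cast hm
  -- The subtracted end term makes the bound telescope in the induction; it is then discarded.
  suffices h : ∑ k ∈ Finset.range n, ((m : ℝ) + k + 1) ^ (-ρ) ≤
      ((m : ℝ) ^ (1 - ρ) - ((m : ℝ) + n) ^ (1 - ρ)) / (ρ - 1) by
    refine h.trans ?_
    gcongr
    linarith [Real.rpow_nonneg (by positivity : (0 : ℝ) ≤ m + n) (1 - ρ)]
  induction n with
  | zero => simp
  | succ n ih =>
    rw [Finset.sum_range_succ]
    set x : ℝ := (m : ℝ) + n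
    have hx : 0 < x := by positivity
    have hlog : 1 / (x + 1) ≤ Real.log ((x + 1) / x) := by
      have h := Real.one_sub_inv_le_log_of_pos (x := (x + 1) / x) (by positivity)
      refine le_trans (le_of_eq ?_) h
      field_simp
      ring
    have h2 : 1 + (ρ - 1) / (x + 1) ≤ ((x + 1) / x) ^ (ρ - 1) := by
      rw [Real.rpow_def_of_pos (by positivity)]
      have h := Real.add_one_le_exp (Real.log ((x + 1) / x) * (ρ - 1))
      have h' : (ρ - 1) * (1 / (x + 1)) ≤ (ρ - 1) * Real.log ((x + 1) / x) := by gcongr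
      rw [mul_one_div] at h'
      linarith
    have h3 : x ^ (1 - ρ) = ((x + 1) / x) ^ (ρ - 1) * (x + 1) ^ (1 - ρ) := by
      rw [Real.div_rpow (by positivity) hx.le, show 1 - ρ = -(ρ - 1) by ring,
        Real.rpow_neg hx.le, Real.rpow_neg (by positivity)]
      field_simp
    have h4 : (x + 1) ^ (1 - ρ) = (x + 1) * (x + 1) ^ (-ρ) := by
      rw [sub_eq_add_neg, Real.rpow_add (by positivity), Real.rpow_one]
    have h5 : (x + 1) ^ (1 - ρ) + (ρ - 1) * (x + 1) ^ (-ρ) ≤ x ^ (1 - ρ) := by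
      rw [h3]
      refine le_trans (le_of_eq ?_) (mul_le_mul_of_nonneg_right h2 (by positivity))
      rw [h4]
      field_simp
    rw [le_div_iff₀ h1] at ih ⊢
    push_cast
    rw [← add_assoc]
    change (_ + (x + 1) ^ (-ρ)) * (ρ - 1) ≤ _ - (x + 1) ^ (1 - ρ)
    linarith

theorem exists_sum_range_rpow_neg_le {ρ : ℝ} (hρ : 1 < ρ) :
    ∃ C > 0, ∀ n, ∑ k ∈ Finset.range n, ((k : ℝ) + 1) ^ (-ρ) ≤ C := by
  refine ⟨1 + 1 / (ρ - 1), by have := sub_pos.2 hρ; positivity, fun n => ?_⟩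
  have h := sum_range_add_rpow_neg_le hρ one_pos n
  have h1 : ∑ k ∈ Finset.range n, ((k : ℝ) + 1) ^ (-ρ) ≤
      ∑ k ∈ Finset.range (n + 1), ((k : ℝ) + 1) ^ (-ρ) :=
    Finset.sum_le_sum_of_subset_of_nonneg (Finset.range_subset_range.2 n.le_succ)
      fun k _ _ => by positivity
  rw [Finset.sum_range_succ'] at h1
  simp only [Nat.cast_one, Real.one_rpow] at h
  have h2 : ∑ k ∈ Finset.range n, (((k + 1 : ℕ) : ℝ) + 1) ^ (-ρ) =
      ∑ k ∈ Finset.range n, (1 + (k : ℝ) + 1) ^ (-ρ) :=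
    Finset.sum_congr rfl fun k _ => by push_cast; rw [add_comm (k : ℝ) 1]
  rw [h2] at h1
  norm_num at h1 h ⊢
  linarith

theorem sum_range_inv_le (n : ℕ) :
    ∑ k ∈ Finset.range n, ((k : ℝ) + 1) ^ (-1 : ℝ) ≤ 1 + Real.log n := by
  have h := harmonic_le_one_add_log n
  simpa [harmonic, Real.rpow_neg_one] using h

theorem log_le_sum_range_inv (n : ℕ) :
    Real.log n ≤ ∑ k ∈ Finset.range n, ((k : ℝ) + 1) ^ (-1 : ℝ) := by
  rcases Nat.eq_zero_or_pos n with rfl | hn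
  · simp
  have h := log_add_one_le_harmonic n
  have h1 : Real.log n ≤ Real.log (n + 1 : ℕ) :=
    Real.log_le_log (by exact_mod_cast hn) (by push_cast; linarith)
  refine h1.trans ?_
  simpa [harmonic, Real.rpow_neg_one] using h

end PowerSums

/-! ### Power sums of the transition probabilities -/

section Collisions

variable {d : ℕ} {S : Finset (Fin d → ℤ)} {p : (Fin d → ℤ) → ℝ}

/-- All but one of the η factors are bounded by the heat kernel estimate; the remaining one has
total mass at most 1. -/
theorem IsStepLaw.exists_sum_walkProb_rpow_le (h : IsStepLaw S p) :
    ∃ K : ℝ, 1 ≤ K ∧ ∀ (η : ℝ), 1 ≤ η → ∀ k (B : Finset (Fin d → ℤ)),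
      ∑ x ∈ B, walkProb S p k x ^ η ≤ K ^ (η - 1) * ((k : ℝ) + 1) ^ (-((η - 1) * (d / 2))) := by
  obtain ⟨K, hK, hKle⟩ := h.exists_walkProb_le
  refine ⟨K, hK, fun η hη k B => ?_⟩
  have hb : 0 ≤ K * ((k : ℝ) + 1) ^ (-((d : ℝ) / 2)) := by positivity
  calc ∑ x ∈ B, walkProb S p k x ^ η
      ≤ ∑ x ∈ B, (K * ((k : ℝ) + 1) ^ (-((d : ℝ) / 2))) ^ (η - 1) * walkProb S p k x := by
        refine Finset.sum_le_sum fun x _ => ?_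
        have h0 := h.walkProb_nonneg k x
        rcases h0.eq_or_lt with h0 | h0
        · rw [← h0, Real.zero_rpow (by linarith), mul_zero]
        · calc walkProb S p k x ^ η = walkProb S p k x ^ (η - 1) * walkProb S p k x := by
                rw [← Real.rpow_add_one h0.ne', sub_add_cancel]
            _ ≤ _ := by
                gcongr
                exact hKle k x
    _ ≤ (K * ((k : ℝ) + 1) ^ (-((d : ℝ) / 2))) ^ (η - 1) * 1 := by
        rw [← Finset.mul_sum]
        gcongr
        exact h.sum_walkProb_le k B
    _ = K ^ (η - 1) * ((k : ℝ) + 1) ^ (-((η - 1) * (d / 2))) := by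
        rw [mul_one, Real.mul_rpow (by linarith) (by positivity), ← Real.rpow_mul (by positivity)]
        congr 2
        ring

theorem IsStepLaw.exists_collisionSum_le (h : IsStepLaw S p) :
    ∃ K : ℝ, 1 ≤ K ∧ ∀ n, collisionSum S p n ≤
      K * ∑ k ∈ Finset.range n, ((k : ℝ) + 1) ^ (-((d : ℝ) / 2)) := by
  obtain ⟨K, hK, hKle⟩ := h.exists_sum_walkProb_rpow_le
  refine ⟨K, hK, fun n => ?_⟩
  rw [collisionSum, Finset.mul_sum]
  refine Finset.sum_le_sum fun k _ => (walkProb_sq_summable k).tsum_le_of_sum_le fun B => ?_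
  have := hKle 2 one_le_two k B
  simp only [Real.rpow_two] at this
  refine this.trans_eq ?_
  norm_num

theorem IsStepLaw.exists_le_collisionSum (h : IsStepLaw S p) :
    ∃ c > 0, ∀ n, c * ∑ k ∈ Finset.range n, ((k : ℝ) + 1) ^ (-((d : ℝ) / 2)) ≤
      collisionSum S p n := by
  obtain ⟨c, hc, hcle⟩ := h.exists_le_tsum_walkProb_sq
  refine ⟨c, hc, fun n => ?_⟩
  rw [collisionSum, Finset.mul_sum]
  exact Finset.sum_le_sum fun k _ => hcle k

end Collisions

/-! ### Lower bound from large noise values -/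

section LowerBound

variable {d : ℕ} {P : (Fin d → ℤ) → (Fin d → ℤ) → ℝ} {Ω : Type*} [MeasurableSpace Ω]
  {Pr : Measure Ω} {F : Measure ℝ} [IsProbabilityMeasure Pr] {S : Finset (Fin d → ℤ)}
  {ε : ℕ → (Fin d → ℤ) → Ω → ℝ}

/-- Repulsion by the noise alone, valid in every dimension. -/
theorem exists_log_rpow_le_meanHeight
    (hsum : ∀ (i : Fin d → ℤ) (f : (Fin d → ℤ) → ℝ),
      ∑' j, P i j * f j = ∑ y ∈ S, P 0 y * f (i + y))
    (hS : IsStepLaw S (P 0)) (hε : IsNoise Pr F ε) (hm : ∀ n i, Measurable (ε n i)) {α : ℝ}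
    (hα : 1 ≤ α) (hF : F ∈ TailClassPlus α) :
    ∃ c > 0, ∀ n : ℕ, 2 ≤ n → c * Real.log n ^ (1 / α) ≤ meanHeight Pr P ε n := by
  have hFp : IsProbabilityMeasure F := (hε.hasLaw 0 0).isProbabilityMeasure_iff.1 inferInstance
  obtain ⟨a, ha, a', ha', hta⟩ := hF
  set μ := fun n => meanHeight Pr P ε n with hμdef
  have hstep (n : ℕ) : μ n + 1 / 2 * F.real (Set.Ioi (2 * μ n + 2)) ≤ μ (n + 1) :=
    meanHeight_succ_ge hsum hS hε hm n
  have hmono : Monotone μ := monotone_nat_of_le_succ fun n =>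
    (le_add_of_nonneg_right (by positivity)).trans (hstep n)
  have hμ0 : μ 0 = 0 := by simp [hμdef, meanHeight, wallProcess]
  have hμ1 : 0 < μ 1 := by
    have h1 := hstep 0
    rw [hμ0] at h1
    have h2 := hta (2 * 0 + 2) (by norm_num)
    have h3 : 0 < a * Real.exp (-a' * (2 * 0 + 2) ^ α) := by positivity
    rw [zero_add] at h1
    exact (mul_pos (by norm_num) (h3.trans_le h2)).trans_le h1
  -- By monotonicity of the means, each of the first `n` increments is at least the one guaranteed
  -- at the final height.
  have hsumstep (n : ℕ) : n * (1 / 2 * F.real (Set.Ioi (2 * μ n + 2))) ≤ μ n := by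
    have h : ∀ k ≤ n, k * (1 / 2 * F.real (Set.Ioi (2 * μ n + 2))) ≤ μ k := by
      intro k hk
      induction k with
      | zero => simp [hμ0]
      | succ k ih =>
        have h1 := ih (by omega)
        have h2 := hstep k
        have h3 : F.real (Set.Ioi (2 * μ n + 2)) ≤ F.real (Set.Ioi (2 * μ k + 2)) := by
          refine measureReal_mono (Set.Ioi_subset_Ioi ?_)
          linarith [hmono (show k ≤ n by omega)]
        push_cast
        linarith
    exact h n le_rfl
  -- From n F̄(z) ≤ z follows log n ≤ log(z/a) + a'z^α. The logarithm is at most z/a, hence at most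
  -- z^α/a since z ≥ 1 and α ≥ 1.
  set G := 1 / a + a'
  have hG : 0 < G := by positivity
  refine ⟨1 / (G ^ (1 / α) * (2 + 2 / μ 1)), by positivity, fun n hn => ?_⟩
  have hn0 : (0 : ℝ) < n := by positivity
  have hμn : μ 1 ≤ μ n := hmono (by omega)
  set z := 2 * μ n + 2 with hz
  have hz1 : 1 ≤ z := by linarith
  have h1 : n * (a * Real.exp (-a' * z ^ α)) ≤ z := by
    have h2 := hta z (by linarith)
    have h3 := hsumstep n
    have h4 : n * (a * Real.exp (-a' * z ^ α)) ≤ n * F.real (Set.Ioi z) := by gcongr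
    linarith
  have hzα : z ≤ z ^ α := by
    simpa using Real.rpow_le_rpow_of_exponent_le hz1 hα
  have h5 : (n : ℝ) ≤ z / a * Real.exp (a' * z ^ α) := by
    rw [neg_mul, Real.exp_neg, ← div_eq_mul_inv, mul_div_assoc', div_le_iff₀ (Real.exp_pos _)] at h1
    rw [div_mul_eq_mul_div, le_div_iff₀ ha]
    linarith
  have h6 : Real.log n ≤ G * z ^ α := by
    have h7 := Real.log_le_log hn0 h5
    rw [Real.log_mul (by positivity) (Real.exp_pos _).ne', Real.log_exp] at h7
    have h8 : Real.log (z / a) ≤ z / a := (Real.log_le_sub_one_of_pos (by positivity)).trans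
      (by linarith)
    have h9 : z / a ≤ 1 / a * z ^ α := by
      rw [div_mul_eq_mul_div, one_mul]; gcongr
    simp only [G, add_mul]
    linarith
  have hlog : 0 ≤ Real.log n := Real.log_natCast_nonneg n
  have h10 : Real.log n ^ (1 / α) ≤ G ^ (1 / α) * z := by
    calc Real.log n ^ (1 / α) ≤ (G * z ^ α) ^ (1 / α) := by gcongr
      _ = G ^ (1 / α) * z := by
        rw [Real.mul_rpow hG.le (by positivity), ← Real.rpow_mul (by linarith),
          mul_one_div_cancel (by linarith), Real.rpow_one]
  -- Positivity of μ₁ and monotonicity absorb the additive 2 in `z` into a multiple of μ_n.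
  have h11 : z ≤ (2 + 2 / μ 1) * μ n := by
    have : 2 / μ 1 * μ n ≥ 2 := by
      rw [div_mul_eq_mul_div, ge_iff_le, le_div_iff₀ hμ1]; linarith
    linarith
  rw [div_mul_eq_mul_div, one_mul, div_le_iff₀ (by positivity)]
  calc Real.log n ^ (1 / α) ≤ G ^ (1 / α) * z := h10
    _ ≤ G ^ (1 / α) * ((2 + 2 / μ 1) * μ n) := by gcongr
    _ = meanHeight Pr P ε n * (G ^ (1 / α) * (2 + 2 / μ 1)) := by simp only [hμdef]; ring

end LowerBound

/-! ### Exponential moments of the free process in dimension at least three -/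

section HighDimension

variable {d : ℕ} {Ω : Type*} [MeasurableSpace Ω]
  {Pr : Measure Ω} {F : Measure ℝ} [IsProbabilityMeasure Pr] {S : Finset (Fin d → ℤ)}
  {p : (Fin d → ℤ) → ℝ} {ε : ℕ → (Fin d → ℤ) → Ω → ℝ}

/-- The function `L` is quadratic in ty up to 1 and of power β beyond. The mixed bound t^β
y^{min(β,2)} uses t ≥ 1 and y ≤ 1 and suits weights dominated by early times. When β ≤ 2, the
quadratic bound holds for all weights and decays faster at late times. -/
theorem exists_log_mgf_bound [IsProbabilityMeasure F] (hF : F.map (fun x : ℝ => -x) = F) {α : ℝ}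
    (hα : 1 < α) (h : F ∈ TailClassMinus α) :
    ∃ C > 0, ∀ t : ℝ, 1 ≤ t → ∃ L : ℝ → ℝ, ∀ y, 0 ≤ y → y ≤ 1 →
      Integrable (fun x => Real.exp (-t * y * x)) F ∧
      ∫ x, Real.exp (-t * y * x) ∂F ≤ Real.exp (L y) ∧
      L y ≤ C * t ^ (α / (α - 1)) * y ^ min (α / (α - 1)) 2 ∧
      (α / (α - 1) ≤ 2 → L y ≤ C * t ^ (2 : ℝ) * y ^ (2 : ℝ)) := by
  obtain ⟨C, hC, hCs⟩ := exists_integral_exp_le_rpow hF hα h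
  set β := α / (α - 1)
  have hβ : 0 < β := div_pos (by linarith) (by linarith)
  refine ⟨C, hC, fun t ht => ⟨fun y => if t * y ≤ 1 then C * (t * y) ^ (2 : ℝ)
    else C * (t * y) ^ β, fun y hy0 hy1 => ?_⟩⟩
  obtain ⟨h1, h2, h3⟩ := hCs (-t * y)
  have habs : |-t * y| = t * y := by
    rw [neg_mul, abs_neg, abs_of_nonneg (by positivity)]
  rw [habs] at h2 h3
  have ht0 : 0 < t := by linarith
  rcases hy0.eq_or_lt with rfl | hy0'
  · refine ⟨h1, by simp, ?_, fun _ => ?_⟩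
    · simp
      positivity
    · simp
  refine ⟨h1, ?_, ?_, fun hβ2 => ?_⟩
  · dsimp only
    split_ifs with hty
    · refine (h2 hty).trans_eq ?_
      rw [Real.rpow_two]
      congr 1
      ring
    · exact h3 (by linarith)
  · dsimp only
    rcases le_total β 2 with hβ2 | hβ2
    · rw [min_eq_left hβ2, mul_assoc, ← Real.mul_rpow ht0.le hy0]
      split_ifs with hty
      · gcongr C * ?_
        exact Real.rpow_le_rpow_of_exponent_ge (by positivity) hty hβ2
      · exact le_rfl
    · rw [min_eq_right hβ2, mul_assoc]
      split_ifs with hty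
      · gcongr C * ?_
        rw [Real.mul_rpow ht0.le hy0]
        gcongr
      · gcongr C * ?_
        rw [Real.mul_rpow ht0.le hy0]
        gcongr ?_ * ?_
        exact Real.rpow_le_rpow_of_exponent_ge hy0' hy1 hβ2
  · dsimp only
    rw [mul_assoc, ← Real.mul_rpow ht0.le hy0]
    split_ifs with hty
    · exact le_rfl
    · gcongr C * ?_
      exact Real.rpow_le_rpow_of_exponent_le (by linarith) hβ2

/-- Exponential moments of the free process, dominated by those of its largest weights. -/
theorem exists_exp_moment_le_of_summable (hS : IsStepLaw S p) (hε : IsNoise Pr F ε)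
    (hm : ∀ n i, Measurable (ε n i)) {α : ℝ} (hα : 1 < α) (hF : F ∈ TailClassMinus α)
    (hd : 1 < (min (α / (α - 1)) 2 - 1) * ((d : ℝ) / 2)) :
    ∃ C > 0, ∀ t : ℝ, 1 ≤ t → ∀ n i,
      Integrable (fun ω => Real.exp (-t * freeHeight S p ε n i ω)) Pr ∧
      ∫ ω, Real.exp (-t * freeHeight S p ε n i ω) ∂Pr ≤
        Real.exp (C * t ^ (α / (α - 1))) := by
  have hFp : IsProbabilityMeasure F := (hε.hasLaw 0 0).isProbabilityMeasure_iff.1 inferInstance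
  obtain ⟨C, hC, hL⟩ := exists_log_mgf_bound hε.symmetric hα hF
  obtain ⟨K, hK, hKle⟩ := hS.exists_sum_walkProb_rpow_le
  obtain ⟨D, hD, hDle⟩ := exists_sum_range_rpow_neg_le hd
  set β := α / (α - 1)
  set η := min β 2
  have hη : 1 ≤ η := by
    by_contra! hc
    have : (η - 1) * ((d : ℝ) / 2) ≤ 0 :=
      mul_nonpos_of_nonpos_of_nonneg (by linarith) (by positivity)
    linarith
  refine ⟨C * K ^ (η - 1) * D, by positivity, fun t ht n i => ?_⟩
  obtain ⟨L, hLt⟩ := hL t ht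
  have h := integrable_exp_freeHeight hS hε hm (t := -t) (L := L)
    (a := fun k => C * t ^ β * (K ^ (η - 1) * ((k : ℝ) + 1) ^ (-((η - 1) * ((d : ℝ) / 2)))))
    (fun y h0 h1 => ⟨(hLt y h0 h1).1, (hLt y h0 h1).2.1⟩) (fun k B => ?_) n i
  · refine ⟨h.1, h.2.trans ?_⟩
    gcongr
    rw [← Finset.mul_sum, ← Finset.mul_sum]
    calc C * t ^ β * (K ^ (η - 1) * _) ≤ C * t ^ β * (K ^ (η - 1) * D) := by
          gcongr
          exact hDle n
      _ = _ := by ring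
  · calc ∑ x ∈ B, L (walkProb S p k x)
        ≤ ∑ x ∈ B, C * t ^ β * walkProb S p k x ^ η := Finset.sum_le_sum fun x _ =>
          (hLt _ (hS.walkProb_nonneg k x) (hS.walkProb_le_one k x)).2.2.1
      _ ≤ _ := by
        rw [← Finset.mul_sum]
        gcongr
        exact hKle η hη k B

/-- Exponential moments of the free process, with the weights split at a time `m`. -/
theorem exists_exp_moment_le_of_split (hS : IsStepLaw S p) (hε : IsNoise Pr F ε)
    (hm : ∀ n i, Measurable (ε n i)) {α : ℝ} (hα : 1 < α) (hF : F ∈ TailClassMinus α)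
    (hβ2 : α / (α - 1) ≤ 2) (hd : 3 ≤ d) :
    ∃ C > 0, ∀ t : ℝ, 1 ≤ t → ∀ n i, ∀ m : ℕ, 0 < m →
      Integrable (fun ω => Real.exp (-t * freeHeight S p ε n i ω)) Pr ∧
      ∫ ω, Real.exp (-t * freeHeight S p ε n i ω) ∂Pr ≤
        Real.exp (C * (t ^ (α / (α - 1)) * ∑ k ∈ Finset.range m,
          ((k : ℝ) + 1) ^ (-((α / (α - 1) - 1) * ((d : ℝ) / 2))) +
          t ^ (2 : ℝ) * (m : ℝ) ^ (1 - (d : ℝ) / 2))) := by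
  have hFp : IsProbabilityMeasure F := (hε.hasLaw 0 0).isProbabilityMeasure_iff.1 inferInstance
  obtain ⟨C, hC, hL⟩ := exists_log_mgf_bound hε.symmetric hα hF
  obtain ⟨K, hK, hKle⟩ := hS.exists_sum_walkProb_rpow_le
  have hd' : (3 : ℝ) ≤ d := by exact_mod_cast hd
  have hρ : 1 < (d : ℝ) / 2 := by linarith
  set β := α / (α - 1) with hβ
  have hβ1 : 1 ≤ β := by rw [hβ, le_div_iff₀ (by linarith)]; linarith
  set ρ := (d : ℝ) / 2
  set E := max (K ^ (β - 1)) (K / (ρ - 1))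
  have hE : 0 < E := lt_max_of_lt_left (by positivity)
  refine ⟨C * E, by positivity, fun t ht n i m hm0 => ?_⟩
  obtain ⟨L, hLt⟩ := hL t ht
  have h := integrable_exp_freeHeight hS hε hm (t := -t) (L := L)
    (a := fun k => if k < m then C * t ^ β * (K ^ (β - 1) * ((k : ℝ) + 1) ^ (-((β - 1) * ρ)))
      else C * t ^ (2 : ℝ) * (K * ((k : ℝ) + 1) ^ (-ρ)))
    (fun y h0 h1 => ⟨(hLt y h0 h1).1, (hLt y h0 h1).2.1⟩) (fun k B => ?_) n i
  · refine ⟨h.1, h.2.trans ?_⟩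
    gcongr
    -- Enlarging the range to m + n spares the comparison of `m` with `n`.
    refine (Finset.sum_le_sum_of_subset_of_nonneg
      (Finset.range_subset_range.2 (Nat.le_add_left n m)) fun k _ _ => ?_).trans ?_
    · split_ifs <;> positivity
    rw [Finset.sum_range_add, mul_add]
    gcongr ?_ + ?_
    · rw [Finset.sum_congr rfl fun k hk => if_pos (Finset.mem_range.1 hk), ← Finset.mul_sum,
        ← Finset.mul_sum]
      have : K ^ (β - 1) ≤ E := le_max_left _ _
      calc C * t ^ β * (K ^ (β - 1) * _) ≤ C * t ^ β * (E * ∑ k ∈ Finset.range m,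
            ((k : ℝ) + 1) ^ (-((β - 1) * ρ))) := by gcongr
        _ = _ := by ring
    · simp only [Nat.not_lt.2 (Nat.le_add_right m _), if_false, ← Finset.mul_sum, Nat.cast_add]
      have h1 := sum_range_add_rpow_neg_le hρ hm0 n
      have h2 : K / (ρ - 1) ≤ E := le_max_right _ _
      have h3 : 0 < ρ - 1 := by linarith
      calc C * t ^ (2 : ℝ) * (K * _) ≤ C * t ^ (2 : ℝ) * (K * ((m : ℝ) ^ (1 - ρ) / (ρ - 1))) := by
            gcongr
        _ = C * t ^ (2 : ℝ) * (K / (ρ - 1) * (m : ℝ) ^ (1 - ρ)) := by ring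
        _ ≤ C * t ^ (2 : ℝ) * (E * (m : ℝ) ^ (1 - ρ)) := by gcongr
        _ = _ := by ring
  · split_ifs with hk
    · calc ∑ x ∈ B, L (walkProb S p k x)
          ≤ ∑ x ∈ B, C * t ^ β * walkProb S p k x ^ β := Finset.sum_le_sum fun x _ => by
            have := (hLt _ (hS.walkProb_nonneg k x) (hS.walkProb_le_one k x)).2.2.1
            rwa [min_eq_left hβ2] at this
        _ ≤ _ := by
          rw [← Finset.mul_sum]
          gcongr
          exact hKle β hβ1 k B
    · calc ∑ x ∈ B, L (walkProb S p k x)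
          ≤ ∑ x ∈ B, C * t ^ (2 : ℝ) * walkProb S p k x ^ (2 : ℝ) := Finset.sum_le_sum fun x _ =>
            (hLt _ (hS.walkProb_nonneg k x) (hS.walkProb_le_one k x)).2.2.2 hβ2
        _ ≤ _ := by
          rw [← Finset.mul_sum]
          gcongr
          refine (hKle 2 one_le_two k B).trans_eq ?_
          norm_num [ρ]

theorem floor_rpow_bounds {t : ℝ} (ht : 1 ≤ t) {s : ℝ} (hs : 0 ≤ s) :
    0 < ⌊t ^ s⌋₊ ∧ ((⌊t ^ s⌋₊ : ℕ) : ℝ) ≤ t ^ s ∧ t ^ s / 2 ≤ ((⌊t ^ s⌋₊ : ℕ) : ℝ) := by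
  have h1 : 1 ≤ t ^ s := Real.one_le_rpow ht hs
  have h2 : 0 < ⌊t ^ s⌋₊ := Nat.floor_pos.2 h1
  have h3 : (1 : ℝ) ≤ ((⌊t ^ s⌋₊ : ℕ) : ℝ) := by exact_mod_cast h2
  exact ⟨h2, Nat.floor_le (by linarith), by linarith [Nat.lt_floor_add_one (t ^ s)]⟩

/-- The split time t^{2/d} is where t k^{-d/2} reaches 1, the boundary between the two regimes of
the moment generating function. This controls the contribution of later times. -/
theorem rpow_two_mul_floor_rpow_le {t : ℝ} (ht : 1 ≤ t) (hd : 3 ≤ d) :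
    t ^ (2 : ℝ) * ((⌊t ^ (2 / (d : ℝ))⌋₊ : ℕ) : ℝ) ^ (1 - (d : ℝ) / 2) ≤
      2 ^ ((d : ℝ) / 2 - 1) * t ^ (1 + 2 / (d : ℝ)) := by
  have hd' : (3 : ℝ) ≤ d := by exact_mod_cast hd
  have ht0 : 0 < t := by linarith
  obtain ⟨h1, h2, h3⟩ := floor_rpow_bounds ht (s := 2 / (d : ℝ)) (by positivity)
  calc t ^ (2 : ℝ) * ((⌊t ^ (2 / (d : ℝ))⌋₊ : ℕ) : ℝ) ^ (1 - (d : ℝ) / 2)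
      ≤ t ^ (2 : ℝ) * (t ^ (2 / (d : ℝ)) / 2) ^ (1 - (d : ℝ) / 2) := by
        gcongr t ^ (2 : ℝ) * ?_
        exact Real.rpow_le_rpow_of_nonpos (by positivity) h3 (by linarith)
    _ = 2 ^ ((d : ℝ) / 2 - 1) * t ^ (1 + 2 / (d : ℝ)) := by
        rw [Real.div_rpow (by positivity) zero_le_two, ← Real.rpow_mul ht0.le, div_eq_mul_inv,
          ← Real.rpow_neg zero_le_two, neg_sub, ← mul_assoc, ← Real.rpow_add ht0, mul_comm]
        congr 2
        field_simp
        ring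

/-- Here θ = (β-1)d/2 < 1, so the early sum grows like m^{1-θ} with m ≈ t^{2/d}. Then β + (2/d)(1-θ)
= 1 + 2/d, the same power as from the late times. -/
theorem exists_exp_moment_le_of_gt (hS : IsStepLaw S p) (hε : IsNoise Pr F ε)
    (hm : ∀ n i, Measurable (ε n i)) {α : ℝ} (hd : 3 ≤ d) (hα : 1 + (d : ℝ) / 2 < α)
    (hF : F ∈ TailClassMinus α) :
    ∃ C > 0, ∀ t : ℝ, 1 ≤ t → ∀ n i,
      Integrable (fun ω => Real.exp (-t * freeHeight S p ε n i ω)) Pr ∧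
      ∫ ω, Real.exp (-t * freeHeight S p ε n i ω) ∂Pr ≤
        Real.exp (C * t ^ (1 + 2 / (d : ℝ))) := by
  have hd' : (3 : ℝ) ≤ d := by exact_mod_cast hd
  have hα1 : 1 < α := by linarith
  have hβ2 : α / (α - 1) ≤ 2 := by rw [div_le_iff₀ (by linarith)]; linarith
  obtain ⟨C, hC, hCt⟩ := exists_exp_moment_le_of_split hS hε hm hα1 hF hβ2 hd
  set β := α / (α - 1) with hβ
  have hβ1 : β - 1 = 1 / (α - 1) := by
    have : α - 1 ≠ 0 := by linarith
    rw [hβ]; field_simp; ring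
  set θ := (β - 1) * ((d : ℝ) / 2) with hθ
  have hθ1 : θ < 1 := by
    rw [hθ, hβ1, div_mul_eq_mul_div, one_mul, div_lt_one (by linarith)]; linarith
  have hθ0 : 0 ≤ θ := by
    rw [hθ, hβ1]
    have : 0 < α - 1 := by linarith
    positivity
  have hθ2 : 0 < 1 - θ := by linarith
  refine ⟨C * (1 / (1 - θ) + 2 ^ ((d : ℝ) / 2 - 1)), by positivity, fun t ht n i => ?_⟩
  have ht0 : 0 < t := by linarith
  obtain ⟨h1, h2, h3⟩ := floor_rpow_bounds ht (s := 2 / (d : ℝ)) (by positivity)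
  obtain ⟨h4, h5⟩ := hCt t ht n i _ h1
  refine ⟨h4, h5.trans ?_⟩
  rw [mul_assoc, add_mul]
  refine Real.exp_le_exp.2 ?_
  gcongr C * (?_ + ?_)
  · calc t ^ β * ∑ k ∈ Finset.range ⌊t ^ (2 / (d : ℝ))⌋₊, ((k : ℝ) + 1) ^ (-θ)
        ≤ t ^ β * ((t ^ (2 / (d : ℝ))) ^ (1 - θ) / (1 - θ)) := by
          gcongr
          refine (sum_range_rpow_neg_le hθ0 hθ1 _).trans ?_
          gcongr
      _ = 1 / (1 - θ) * (t ^ β * t ^ (2 / (d : ℝ) * (1 - θ))) := by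
          rw [← Real.rpow_mul ht0.le]; ring
      _ = 1 / (1 - θ) * t ^ (1 + 2 / (d : ℝ)) := by
          rw [← Real.rpow_add ht0]
          congr 2
          rw [hθ]
          field_simp
          ring
  · exact rpow_two_mul_floor_rpow_le ht hd

/-- The critical case θ = 1: the early sum is harmonic and produces the factor 1 + log t. -/
theorem exists_exp_moment_le_of_eq (hS : IsStepLaw S p) (hε : IsNoise Pr F ε)
    (hm : ∀ n i, Measurable (ε n i)) (hd : 3 ≤ d) (hF : F ∈ TailClassMinus (1 + (d : ℝ) / 2)) :
    ∃ C > 0, ∀ t : ℝ, 1 ≤ t → ∀ n i,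
      Integrable (fun ω => Real.exp (-t * freeHeight S p ε n i ω)) Pr ∧
      ∫ ω, Real.exp (-t * freeHeight S p ε n i ω) ∂Pr ≤
        Real.exp (C * (t ^ (1 + 2 / (d : ℝ)) * (1 + Real.log t))) := by
  have hd' : (3 : ℝ) ≤ d := by exact_mod_cast hd
  have hβ : (1 + (d : ℝ) / 2) / (1 + (d : ℝ) / 2 - 1) = 1 + 2 / (d : ℝ) := by
    rw [add_sub_cancel_left]; field_simp; ring
  have hd2 : 2 / (d : ℝ) ≤ 1 := by rw [div_le_one (by linarith)]; linarith
  obtain ⟨C, hC, hCt⟩ := exists_exp_moment_le_of_split hS hε hm (α := 1 + (d : ℝ) / 2)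
    (by linarith) hF (by rw [hβ]; linarith) hd
  refine ⟨C * (1 + 2 ^ ((d : ℝ) / 2 - 1)), by positivity, fun t ht n i => ?_⟩
  have ht0 : 0 < t := by linarith
  have hlogt : 0 ≤ Real.log t := Real.log_nonneg ht
  obtain ⟨h1, h2, h3⟩ := floor_rpow_bounds ht (s := 2 / (d : ℝ)) (by positivity)
  obtain ⟨h4, h5⟩ := hCt t ht n i _ h1
  refine ⟨h4, h5.trans ?_⟩
  rw [hβ, mul_assoc, add_mul, add_sub_cancel_left,
    show 2 / (d : ℝ) * ((d : ℝ) / 2) = 1 by field_simp]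
  refine Real.exp_le_exp.2 ?_
  gcongr C * (?_ + ?_)
  · rw [one_mul]
    gcongr
    refine (sum_range_inv_le _).trans ?_
    have hle : Real.log ((⌊t ^ (2 / (d : ℝ))⌋₊ : ℕ) : ℝ) ≤ Real.log t := by
      calc Real.log ((⌊t ^ (2 / (d : ℝ))⌋₊ : ℕ) : ℝ) ≤ Real.log (t ^ (2 / (d : ℝ))) :=
            Real.log_le_log (by exact_mod_cast h1) h2
        _ = 2 / (d : ℝ) * Real.log t := Real.log_rpow ht0 _
        _ ≤ Real.log t := mul_le_of_le_one_left hlogt hd2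
    linarith
  · refine (rpow_two_mul_floor_rpow_le ht hd).trans ?_
    gcongr
    exact le_mul_of_one_le_right (by positivity) (by linarith)

/-- Optimising (log n + t^γ)/t gives (log n)^{1-1/γ}, hence the form of the identity for γ. Below
the critical exponent γ = α/(α-1), above it γ = 1 + 2/d. -/
theorem exists_exp_moment_le_of_ne (hS : IsStepLaw S p) (hε : IsNoise Pr F ε)
    (hm : ∀ n i, Measurable (ε n i)) {α : ℝ} (hd : 3 ≤ d) (hα : 1 < α)
    (hne : α ≠ 1 + (d : ℝ) / 2) (hF : F ∈ TailClassMinus α) :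
    ∃ γ > 1, 1 - 1 / γ = max (1 / α) (2 / (2 + (d : ℝ))) ∧
      ∃ C > 0, ∀ t : ℝ, 1 ≤ t → ∀ n i,
        Integrable (fun ω => Real.exp (-t * freeHeight S p ε n i ω)) Pr ∧
        ∫ ω, Real.exp (-t * freeHeight S p ε n i ω) ∂Pr ≤ Real.exp (C * t ^ γ) := by
  have hd' : (3 : ℝ) ≤ d := by exact_mod_cast hd
  rcases lt_or_gt_of_ne hne with hlt | hgt
  · have hβ1 : α / (α - 1) - 1 = 1 / (α - 1) := by
      have : α - 1 ≠ 0 := by linarith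
      field_simp; ring
    refine ⟨α / (α - 1), by rw [gt_iff_lt, lt_div_iff₀ (by linarith)]; linarith, ?_,
      exists_exp_moment_le_of_summable hS hε hm hα hF ?_⟩
    · rw [max_eq_left]
      · field_simp; ring
      · rw [div_le_div_iff₀ (by linarith) (by linarith)]; linarith
    · rcases le_total (α / (α - 1)) 2 with h2 | h2
      · rw [min_eq_left h2, hβ1, div_mul_eq_mul_div, one_mul, lt_div_iff₀ (by linarith)]
        linarith
      · rw [min_eq_right h2]; linarith
  · refine ⟨1 + 2 / (d : ℝ), by have : 0 < 2 / (d : ℝ) := by positivity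
                                linarith, ?_, exists_exp_moment_le_of_gt hS hε hm hd hgt hF⟩
    rw [max_eq_right]
    · field_simp; ring
    · rw [div_le_div_iff₀ (by linarith) (by linarith)]; linarith

end HighDimension

/-! ### Optimisation over t in each dimension -/

section Bounds

variable {d : ℕ} {P : (Fin d → ℤ) → (Fin d → ℤ) → ℝ} {Ω : Type*} [MeasurableSpace Ω]
  {Pr : Measure Ω} {F : Measure ℝ} {S : Finset (Fin d → ℤ)}
  {ε : ℕ → (Fin d → ℤ) → Ω → ℝ}

theorem exists_log_cone_card_le (d R : ℕ) :
    ∃ D > 0, ∀ n : ℕ, 2 ≤ n →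
      Real.log (((n : ℝ) + 1) * (2 * (R * n) + 1) ^ d) ≤ D * Real.log n := by
  have hl2 : 0 < Real.log 2 := Real.log_pos one_lt_two
  have hR : 0 ≤ Real.log (2 * R + 1) := Real.log_nonneg (by linarith [R.cast_nonneg (α := ℝ)])
  refine ⟨2 + d * (Real.log (2 * R + 1) / Real.log 2 + 1), by positivity, fun n hn => ?_⟩
  have hn' : (2 : ℝ) ≤ n := by exact_mod_cast hn
  have h0 : (0 : ℝ) ≤ R := R.cast_nonneg
  have hlog : Real.log 2 ≤ Real.log n := Real.log_le_log two_pos hn'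
  have h1 : Real.log ((n : ℝ) + 1) ≤ 2 * Real.log n := by
    rw [← Nat.cast_ofNat (n := 2), ← Real.log_pow]
    refine Real.log_le_log (by positivity) ?_
    norm_num
    nlinarith
  have h2 : Real.log (2 * (R * n) + 1) ≤ Real.log (2 * R + 1) + Real.log n := by
    rw [← Real.log_mul (by positivity) (by positivity)]
    refine Real.log_le_log (by positivity) ?_
    nlinarith
  have h3 : Real.log (2 * R + 1) ≤ Real.log (2 * R + 1) / Real.log 2 * Real.log n := by
    rw [div_mul_eq_mul_div, le_div_iff₀ hl2]
    gcongr
  rw [Real.log_mul (by positivity) (by positivity), Real.log_pow]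
  have h4 : (d : ℝ) * Real.log (2 * (R * n) + 1) ≤
      d * (Real.log (2 * R + 1) / Real.log 2 * Real.log n + Real.log n) := by
    gcongr
    linarith
  linarith

/-- Needed because the constants of the theorem are chosen before α is quantified. -/
theorem tailClass_exponent_unique {α α' : ℝ} (hα : 0 < α) (hα' : 0 < α') (h : F ∈ TailClass α)
    (h' : F ∈ TailClass α') : α = α' := by
  wlog hlt : α < α' generalizing α α' with H
  · rcases (not_lt.1 hlt).eq_or_lt with h1 | h1
    · exact h1.symm
    · exact (H hα' hα h' h h1).symm
  exfalso
  obtain ⟨a, ha, b, hb, hab⟩ := h.2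
  obtain ⟨a', ha', b', hb', hab'⟩ := h'.1
  have h1 : ∀ x : ℝ, 0 < x → b' * x ^ α' - b * x ^ α ≤ Real.log (a' / a) := by
    intro x hx
    have h2 := (hab x hx).trans (hab' x hx)
    rw [Real.le_log_iff_exp_le (by positivity), le_div_iff₀ ha, Real.exp_sub]
    rw [neg_mul, neg_mul, Real.exp_neg, Real.exp_neg, ← div_eq_mul_inv, ← div_eq_mul_inv,
      div_le_div_iff₀ (Real.exp_pos _) (Real.exp_pos _)] at h2
    rw [div_mul_eq_mul_div, div_le_iff₀ (Real.exp_pos _)]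
    linarith
  have hlim : Filter.Tendsto (fun x : ℝ => x ^ α * (b' * x ^ (α' - α) - b)) Filter.atTop
      Filter.atTop :=
    (tendsto_rpow_atTop hα).atTop_mul_atTop₀ (Filter.tendsto_atTop_add_const_right _ (-b)
      ((tendsto_rpow_atTop (by linarith)).const_mul_atTop hb'))
  obtain ⟨x, hx, hx0⟩ := ((hlim.eventually_gt_atTop (Real.log (a' / a))).and
    (Filter.eventually_gt_atTop 0)).exists
  have h3 : x ^ α * (b' * x ^ (α' - α) - b) = b' * x ^ α' - b * x ^ α := by
    rw [mul_sub, mul_left_comm, ← Real.rpow_add hx0, add_sub_cancel, mul_comm b]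
  rw [h3] at hx
  exact absurd (h1 x hx0) (not_le.2 hx)

theorem ne_dirac_of_tailClassPlus {α : ℝ} (h : F ∈ TailClassPlus α) : F ≠ Measure.dirac 0 := by
  rintro rfl
  obtain ⟨a, ha, b, hb, hab⟩ := h
  have h1 := hab 1 one_pos
  have h2 : (Measure.dirac (0 : ℝ)).real (Set.Ioi 1) = 0 := by
    rw [measureReal_def, Measure.dirac_apply' _ measurableSet_Ioi]
    simp
  rw [h2] at h1
  have : 0 < a * Real.exp (-b * 1 ^ α) := by positivity
  linarith

theorem collisionSum_mono {p : (Fin d → ℤ) → ℝ} : Monotone (collisionSum S p) := fun _ _ hkn =>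
  Finset.sum_le_sum_of_subset_of_nonneg (Finset.range_subset_range.2 hkn)
    fun _ _ _ => tsum_nonneg fun _ => sq_nonneg _

variable [IsProbabilityMeasure Pr]
  (hsum : ∀ (i : Fin d → ℤ) (f : (Fin d → ℤ) → ℝ),
    ∑' j, P i j * f j = ∑ y ∈ S, P 0 y * f (i + y))
  (hS : IsStepLaw S (P 0)) (hε : IsNoise Pr F ε) (hm : ∀ n i, Measurable (ε n i))
include hsum hS hε

theorem exists_meanHeight_le_of_exp_moment :
    ∃ D > 0, ∀ n : ℕ, 2 ≤ n → ∀ t A : ℝ, 0 < t →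
      (∀ k ≤ n, ∀ i, Integrable (fun ω => Real.exp (-t * freeHeight S (P 0) ε k i ω)) Pr ∧
        ∫ ω, Real.exp (-t * freeHeight S (P 0) ε k i ω) ∂Pr ≤ Real.exp A) →
      meanHeight Pr P ε n ≤ (D * Real.log n + A) / t := by
  obtain ⟨R, hR⟩ : ∃ R : ℕ, ∀ y ∈ S, ∀ l, |y l| ≤ R := by
    refine ⟨∑ y ∈ S, ∑ l, (y l).natAbs, fun y hy l => ?_⟩
    have h1 := Finset.single_le_sum (f := fun l => (y l).natAbs) (fun _ _ => Nat.zero_le _)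
      (Finset.mem_univ l)
    have h2 := Finset.single_le_sum (f := fun y : Fin d → ℤ => ∑ l, (y l).natAbs)
      (fun _ _ => Nat.zero_le _) hy
    have h3 : (y l).natAbs ≤ ∑ y ∈ S, ∑ l, (y l).natAbs := h1.trans h2
    rw [Int.abs_eq_natAbs]
    exact_mod_cast h3
  obtain ⟨D, hD, hDle⟩ := exists_log_cone_card_le d R
  refine ⟨D, hD, fun n hn t A ht h => ?_⟩
  refine (meanHeight_le_of_exp_moment hsum hS hε hR ht h).trans ?_
  gcongr
  exact hDle n hn

include hm

/-- A tail in `TailClassMinus 1` yields exponential moments only for small t, hence the ceiling `b`.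
Dimension one takes t small with `n`; otherwise t = b is used. -/
theorem exists_meanHeight_le_collisionSum (hF : F ∈ TailClassMinus 1) :
    ∃ b > 0, ∃ C > 0, ∀ n : ℕ, 2 ≤ n → ∀ t, 0 < t → t ≤ b →
      meanHeight Pr P ε n ≤ (C * Real.log n + C * t ^ 2 * collisionSum S (P 0) n) / t := by
  have hFp : IsProbabilityMeasure F := (hε.hasLaw 0 0).isProbabilityMeasure_iff.1 inferInstance
  obtain ⟨b, hb, hint⟩ := exists_integrable_exp_abs_rpow hε.symmetric one_pos hF
  simp only [Real.rpow_one] at hint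
  obtain ⟨C, hC, hCs⟩ := exists_integral_exp_le_sq hε.symmetric hb hint
  obtain ⟨D, hD, hDle⟩ := exists_meanHeight_le_of_exp_moment hsum hS hε
  refine ⟨b / 2, by positivity, max C D, by positivity, fun n hn t ht htb => ?_⟩
  have h := hDle n hn t (C * t ^ 2 * collisionSum S (P 0) n) ht fun k hk i => by
    obtain ⟨h1, h2⟩ := integrable_exp_freeHeight_of_sq hS hε hm hC.le hint hCs (t := -t)
      (by rwa [abs_neg, abs_of_pos ht]) k i
    refine ⟨h1, h2.trans ?_⟩
    rw [neg_sq]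
    gcongr
    exact collisionSum_mono hk
  refine h.trans ?_
  have hlog : 0 ≤ Real.log n := Real.log_natCast_nonneg n
  have hcol : 0 ≤ collisionSum S (P 0) n :=
    zero_le_one.trans (one_le_collisionSum n (by omega))
  gcongr
  · exact le_max_right _ _
  · exact le_max_left _ _

theorem exists_meanHeight_bounds_one (hd : d = 1) (hF : F ∈ TailClassMinus 1)
    (hF0 : F ≠ Measure.dirac 0) :
    ∃ c > 0, ∃ C > 0, ∀ n : ℕ, 2 ≤ n → c * (n : ℝ) ^ (1 / 4 : ℝ) ≤ meanHeight Pr P ε n ∧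
      meanHeight Pr P ε n ≤ C * (n : ℝ) ^ (1 / 4 : ℝ) * √(Real.log n) := by
  obtain ⟨c₁, hc₁, h₁⟩ := exists_sqrt_collisionSum_le_meanHeight hsum hS hε hm hF hF0
  obtain ⟨c₂, hc₂, h₂⟩ := hS.exists_le_collisionSum
  obtain ⟨K, hK, hKle⟩ := hS.exists_collisionSum_le
  obtain ⟨b, hb, C, hC, hCle⟩ := exists_meanHeight_le_collisionSum hsum hS hε hm hF
  have hexp : -((d : ℝ) / 2) = -(1 / 2 : ℝ) := by rw [hd]; norm_num
  rw [hexp] at h₂ hKle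
  refine ⟨c₁ * √c₂, by positivity, 2 * C / b + C * K * b, by positivity, fun n hn => ⟨?_, ?_⟩⟩
  · have hn0 : (0 : ℝ) < n := by positivity
    have h3 : (n : ℝ) ^ (1 / 2 : ℝ) ≤ ∑ k ∈ Finset.range n, ((k : ℝ) + 1) ^ (-(1 / 2 : ℝ)) := by
      calc (n : ℝ) ^ (1 / 2 : ℝ) = n * (n : ℝ) ^ (-(1 / 2 : ℝ)) := by
            rw [← Real.rpow_one_add' hn0.le (by norm_num)]; norm_num
        _ = ∑ k ∈ Finset.range n, (n : ℝ) ^ (-(1 / 2 : ℝ)) := by simp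
        _ ≤ _ := by
            refine Finset.sum_le_sum fun k hk => ?_
            refine Real.rpow_le_rpow_of_nonpos (by positivity) ?_ (by norm_num)
            exact_mod_cast Finset.mem_range.1 hk
    calc c₁ * √c₂ * (n : ℝ) ^ (1 / 4 : ℝ) = c₁ * √(c₂ * (n : ℝ) ^ (1 / 2 : ℝ)) := by
          rw [Real.sqrt_mul hc₂.le, Real.sqrt_eq_rpow ((n : ℝ) ^ (1 / 2 : ℝ)),
            ← Real.rpow_mul hn0.le, mul_assoc]
          norm_num
      _ ≤ c₁ * √(collisionSum S (P 0) n) := by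
          gcongr
          refine le_trans ?_ (h₂ n)
          gcongr
      _ ≤ _ := h₁ n
  · have hn0 : (0 : ℝ) < n := by positivity
    have hl0 : 0 < Real.log n := Real.log_pos (by exact_mod_cast hn)
    set x : ℝ := (n : ℝ) ^ (1 / 4 : ℝ) with hx
    have hx0 : 0 < x := by positivity
    have hx2 : x ^ 2 = (n : ℝ) ^ (1 / 2 : ℝ) := by
      rw [hx, ← Real.rpow_natCast, ← Real.rpow_mul hn0.le]; norm_num
    set l := √(Real.log n) with hl
    have hl0' : 0 < l := Real.sqrt_pos.2 hl0
    have hl2 : l ^ 2 = Real.log n := Real.sq_sqrt hl0.le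
    have hlx : l ≤ 2 * x := by
      have h4 := Real.log_le_rpow_div hn0.le (ε := 1 / 2) (by norm_num)
      rw [← hx2, ← hl2] at h4
      refine le_of_sq_le_sq ?_ (by positivity)
      nlinarith
    have hcol : collisionSum S (P 0) n ≤ 2 * K * x ^ 2 := by
      have h5 := sum_range_rpow_neg_le (θ := 1 / 2) (by norm_num) (by norm_num) n
      rw [show (1 : ℝ) - 1 / 2 = 1 / 2 by norm_num, ← hx2] at h5
      calc collisionSum S (P 0) n ≤ _ := hKle n
        _ ≤ K * (x ^ 2 / (1 / 2)) := by gcongr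
        _ = _ := by ring
    -- The optimal order of t is √(log n / collision number), that is l/x up to constants; l ≤ 2x
    -- keeps it below `b`.
    have h := hCle n hn (b / 2 * (l / x)) (by positivity) (by
      have : l / x ≤ 2 := (div_le_iff₀ hx0).2 hlx
      nlinarith)
    refine h.trans ?_
    calc (C * Real.log n + C * (b / 2 * (l / x)) ^ 2 * collisionSum S (P 0) n) / (b / 2 * (l / x))
        ≤ (C * Real.log n + C * (b / 2 * (l / x)) ^ 2 * (2 * K * x ^ 2)) / (b / 2 * (l / x)) := by
          gcongr
      _ = (2 * C / b + C * K * b) * x * l := by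
          rw [← hl2]
          field_simp

theorem exists_meanHeight_bounds_two (hd : d = 2) {α : ℝ} (hα : 1 ≤ α) (hF : F ∈ TailClass α) :
    ∃ c > 0, ∃ C > 0, ∀ n : ℕ, 2 ≤ n →
      c * Real.log n ^ max (1 / α) (1 / 2) ≤ meanHeight Pr P ε n ∧
      meanHeight Pr P ε n ≤ C * Real.log n := by
  have hF1 := tailClassMinus_subset_one hα hF.1
  obtain ⟨c₀, hc₀, h₀⟩ := exists_log_rpow_le_meanHeight hsum hS hε hm hα hF.2
  obtain ⟨c₁, hc₁, h₁⟩ := exists_sqrt_collisionSum_le_meanHeight hsum hS hε hm hF1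
    (ne_dirac_of_tailClassPlus hF.2)
  obtain ⟨c₂, hc₂, h₂⟩ := hS.exists_le_collisionSum
  obtain ⟨K, hK, hKle⟩ := hS.exists_collisionSum_le
  obtain ⟨b, hb, C, hC, hCle⟩ := exists_meanHeight_le_collisionSum hsum hS hε hm hF1
  have hexp : -((d : ℝ) / 2) = -1 := by rw [hd]; norm_num
  rw [hexp] at h₂ hKle
  have hl2 : 0 < Real.log 2 := Real.log_pos one_lt_two
  refine ⟨min c₀ (c₁ * √c₂), by positivity, C / b + C * b * K * (1 / Real.log 2 + 1),
    by positivity, fun n hn => ⟨?_, ?_⟩⟩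
  · have hlog : 0 ≤ Real.log n := Real.log_natCast_nonneg n
    rcases max_cases (1 / α) (1 / 2 : ℝ) with ⟨h, _⟩ | ⟨h, _⟩ <;> rw [h]
    · refine le_trans ?_ (h₀ n hn)
      gcongr
      exact min_le_left _ _
    · refine le_trans ?_ (h₁ n)
      calc min c₀ (c₁ * √c₂) * Real.log n ^ (1 / 2 : ℝ) ≤ c₁ * √c₂ * √(Real.log n) := by
            rw [← Real.sqrt_eq_rpow]
            gcongr
            exact min_le_right _ _
        _ = c₁ * √(c₂ * Real.log n) := by rw [Real.sqrt_mul hc₂.le, mul_assoc]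
        _ ≤ c₁ * √(collisionSum S (P 0) n) := by
            gcongr
            refine le_trans ?_ (h₂ n)
            gcongr
            exact log_le_sum_range_inv n
  · have hlog : Real.log 2 ≤ Real.log n := Real.log_le_log two_pos (by exact_mod_cast hn)
    have hcol : collisionSum S (P 0) n ≤ K * ((1 / Real.log 2 + 1) * Real.log n) := by
      refine (hKle n).trans ?_
      gcongr
      refine (sum_range_inv_le n).trans ?_
      have : 1 ≤ 1 / Real.log 2 * Real.log n := by
        rw [div_mul_eq_mul_div, le_div_iff₀ hl2]; linarith
      linarith
    refine (hCle n hn b hb le_rfl).trans ?_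
    calc (C * Real.log n + C * b ^ 2 * collisionSum S (P 0) n) / b
        ≤ (C * Real.log n + C * b ^ 2 * (K * ((1 / Real.log 2 + 1) * Real.log n))) / b := by
          gcongr
      _ = _ := by field_simp

theorem exists_meanHeight_le_of_ne (hd : 3 ≤ d) {α : ℝ} (hα : 1 ≤ α)
    (hne : α ≠ 1 + (d : ℝ) / 2) (hF : F ∈ TailClassMinus α) :
    ∃ C > 0, ∀ n : ℕ, 2 ≤ n →
      meanHeight Pr P ε n ≤ C * Real.log n ^ max (1 / α) (2 / (2 + (d : ℝ))) := by
  have hd' : (3 : ℝ) ≤ d := by exact_mod_cast hd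
  have hl2 : 0 < Real.log 2 := Real.log_pos one_lt_two
  rcases hα.eq_or_lt with rfl | hα
  · obtain ⟨K, hK, hKle⟩ := hS.exists_collisionSum_le
    obtain ⟨b, hb, C, hC, hCle⟩ := exists_meanHeight_le_collisionSum hsum hS hε hm hF
    obtain ⟨D, hD, hDle⟩ := exists_sum_range_rpow_neg_le (ρ := (d : ℝ) / 2) (by linarith)
    refine ⟨C / b + C * b * K * D / Real.log 2, by positivity, fun n hn => ?_⟩
    have hlog : Real.log 2 ≤ Real.log n := Real.log_le_log two_pos (by exact_mod_cast hn)
    rw [max_eq_left (by rw [div_le_div_iff₀ (by linarith) one_pos]; linarith), div_one,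
      Real.rpow_one]
    refine (hCle n hn b hb le_rfl).trans ?_
    have hcol : collisionSum S (P 0) n ≤ K * D * (Real.log n / Real.log 2) := by
      calc collisionSum S (P 0) n ≤ _ := hKle n
        _ ≤ K * D := by gcongr; exact hDle n
        _ ≤ _ := le_mul_of_one_le_right (by positivity) ((one_le_div hl2).2 hlog)
    calc (C * Real.log n + C * b ^ 2 * collisionSum S (P 0) n) / b
        ≤ (C * Real.log n + C * b ^ 2 * (K * D * (Real.log n / Real.log 2))) / b := by gcongr
      _ = _ := by field_simp
  · obtain ⟨γ, hγ, hγeq, C, hC, hCt⟩ := exists_exp_moment_le_of_ne hS hε hm hd hα hne hF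
    obtain ⟨D, hD, hDle⟩ := exists_meanHeight_le_of_exp_moment hsum hS hε
    rw [← hγeq]
    refine ⟨(D + C / Real.log 2) * Real.log 2 ^ (1 / γ), by positivity, fun n hn => ?_⟩
    have hlog : Real.log 2 ≤ Real.log n := Real.log_le_log two_pos (by exact_mod_cast hn)
    set ℓ := Real.log n
    have hℓ : 0 < ℓ := by linarith
    -- This balances log n against t^γ; dividing by log 2 ensures t ≥ 1 from n = 2 on.
    set t : ℝ := (ℓ / Real.log 2) ^ (1 / γ) with ht
    have ht1 : 1 ≤ t := Real.one_le_rpow ((one_le_div hl2).2 hlog) (by positivity)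
    have htγ : t ^ γ = ℓ / Real.log 2 := by
      rw [ht, ← Real.rpow_mul (by positivity), one_div_mul_cancel (by positivity), Real.rpow_one]
    have h := hDle n hn t (C * t ^ γ) (by linarith) fun k _ i => hCt t ht1 k i
    refine h.trans_eq ?_
    change (D * ℓ + C * t ^ γ) / t = _
    rw [htγ, ht, Real.div_rpow hℓ.le hl2.le, Real.rpow_sub hℓ, Real.rpow_one]
    field_simp

theorem exists_meanHeight_le_of_eq (hd : 3 ≤ d) (hF : F ∈ TailClassMinus (1 + (d : ℝ) / 2)) :
    ∃ C > 0, ∀ n : ℕ, 3 ≤ n →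
      meanHeight Pr P ε n ≤ C * Real.log n ^ (2 / (2 + (d : ℝ))) *
          Real.log (Real.log n) ^ ((d : ℝ) / (2 + (d : ℝ))) := by
  have hd' : (3 : ℝ) ≤ d := by exact_mod_cast hd
  obtain ⟨C, hC, hCt⟩ := exists_exp_moment_le_of_eq hS hε hm hd hF
  obtain ⟨D, hD, hDle⟩ := exists_meanHeight_le_of_exp_moment hsum hS hε
  have hlog3 : 1 < Real.log 3 := by
    rw [Real.lt_log_iff_exp_lt (by norm_num)]
    linarith [Real.exp_one_lt_d9]
  set m₀ := Real.log (Real.log 3)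
  have hm₀ : 0 < m₀ := Real.log_pos hlog3
  -- Chosen so that 1 + log t ≤ B log log n. The estimate needs log log n bounded away from 0, which
  -- n ≥ 3 provides.
  set B := 1 + (1 + |Real.log m₀|) / m₀
  have hB : 0 < B := by positivity
  refine ⟨D + C * B, by positivity, fun n hn => ?_⟩
  have hℓ3 : Real.log 3 ≤ Real.log n := Real.log_le_log (by norm_num) (by exact_mod_cast hn)
  set ℓ := Real.log n
  have hℓ1 : 1 < ℓ := by linarith
  set m := Real.log ℓ
  have hmm : m₀ ≤ m := Real.log_le_log (by linarith) hℓ3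
  have hm0 : 0 < m := by linarith
  have hmℓ : m ≤ ℓ := (Real.log_le_sub_one_of_pos (by linarith)).trans (by linarith)
  set s : ℝ := (d : ℝ) / (2 + d) with hs
  have hs0 : 0 < s := by positivity
  have hs1 : s ≤ 1 := by rw [hs, div_le_one (by positivity)]; linarith
  -- As s(1 + 2/d) = 1, this gives t^{1+2/d} = ℓ/m, and the factor 1 + log t, of order at most `m`,
  -- brings the exponent back to order ℓ.
  set t : ℝ := (ℓ / m) ^ s with ht
  have hratio : 1 ≤ ℓ / m := (one_le_div hm0).2 hmℓ
  have ht1 : 1 ≤ t := Real.one_le_rpow hratio hs0.le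
  have ht0 : 0 < t := by linarith
  have hlogt : 1 + Real.log t ≤ B * m := by
    have h1 : Real.log t = s * (m - Real.log m) := by
      rw [ht, Real.log_rpow (by positivity), Real.log_div (by linarith) hm0.ne']
    have h2 : Real.log t ≤ m - Real.log m := by
      rw [h1]
      refine mul_le_of_le_one_left ?_ hs1
      linarith [Real.log_le_sub_one_of_pos hm0]
    have h3 : Real.log m₀ ≤ Real.log m := Real.log_le_log hm₀ hmm
    have h4 : 1 + |Real.log m₀| ≤ (1 + |Real.log m₀|) / m₀ * m := by
      rw [div_mul_eq_mul_div, le_div_iff₀ hm₀]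
      gcongr
    have h5 := neg_abs_le (Real.log m₀)
    simp only [B, add_mul, one_mul]
    linarith
  have hℓt : ℓ / t = ℓ ^ (2 / (2 + (d : ℝ))) * m ^ s := by
    have : 2 / (2 + (d : ℝ)) = 1 - s := by rw [hs]; field_simp; ring
    rw [this, ht, Real.div_rpow (by linarith) hm0.le, Real.rpow_sub (by linarith), Real.rpow_one]
    field_simp
  have htm : t ^ (2 / (d : ℝ)) * m = ℓ ^ (2 / (2 + (d : ℝ))) * m ^ s := by
    rw [ht, ← Real.rpow_mul (by positivity), Real.div_rpow (by linarith) hm0.le,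
      show s * (2 / (d : ℝ)) = 2 / (2 + (d : ℝ)) by rw [hs]; field_simp,
      show s = 1 - 2 / (2 + (d : ℝ)) by rw [hs]; field_simp; ring,
      Real.rpow_sub hm0, Real.rpow_one]
    field_simp
  refine (hDle n (by omega) t _ ht0 fun k _ i => hCt t ht1 k i).trans ?_
  calc (D * ℓ + C * (t ^ (1 + 2 / (d : ℝ)) * (1 + Real.log t))) / t
      ≤ (D * ℓ + C * (t ^ (1 + 2 / (d : ℝ)) * (B * m))) / t := by gcongr
    _ = D * (ℓ / t) + C * B * (t ^ (2 / (d : ℝ)) * m) := by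
        rw [Real.rpow_add ht0, Real.rpow_one]
        field_simp
    _ = _ := by rw [hℓt, htm]; ring

end Bounds

/-! ### Assembly of the cases -/

theorem exists_meanHeight_bounds {d : ℕ} (P : (Fin d → ℤ) → (Fin d → ℤ) → ℝ)
    (hP : IsHarnessMatrix P) {Ω : Type*} [MeasurableSpace Ω] (Pr : Measure Ω)
    [IsProbabilityMeasure Pr] (F : Measure ℝ) (ε : ℕ → (Fin d → ℤ) → Ω → ℝ)
    (hε : IsNoise Pr F ε) (hm : ∀ n i, Measurable (ε n i)) :
    ∃ c C : ℝ, 0 < c ∧ 0 < C ∧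
      (d = 1 → F ∈ TailClassMinus 1 → F ≠ Measure.dirac 0 → ∀ n : ℕ, 2 ≤ n →
        c * (n : ℝ) ^ (1 / 4 : ℝ) ≤ meanHeight Pr P ε n ∧
        meanHeight Pr P ε n ≤ C * (n : ℝ) ^ (1 / 4 : ℝ) * √(Real.log n)) ∧
      (d = 2 → ∀ α : ℝ, 1 ≤ α → F ∈ TailClass α → ∀ n : ℕ, 2 ≤ n →
        c * Real.log n ^ max (1 / α) (1 / 2) ≤ meanHeight Pr P ε n ∧
        meanHeight Pr P ε n ≤ C * Real.log n) ∧
      (3 ≤ d → ∀ α : ℝ, 1 ≤ α → α ≠ 1 + (d : ℝ) / 2 → F ∈ TailClass α → ∀ n : ℕ, 2 ≤ n →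
        c * Real.log n ^ (1 / α) ≤ meanHeight Pr P ε n ∧
        meanHeight Pr P ε n ≤ C * Real.log n ^ max (1 / α) (2 / (2 + (d : ℝ)))) ∧
      (3 ≤ d → F ∈ TailClass (1 + (d : ℝ) / 2) → ∀ n : ℕ, 3 ≤ n →
        c * Real.log n ^ (2 / (2 + (d : ℝ))) ≤ meanHeight Pr P ε n ∧
        meanHeight Pr P ε n ≤ C * Real.log n ^ (2 / (2 + (d : ℝ))) *
          Real.log (Real.log n) ^ ((d : ℝ) / (2 + (d : ℝ)))) := by
  obtain ⟨S, hS, hsum⟩ := hP.exists_isStepLaw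
  by_cases hd1 : d = 1
  · by_cases hF : F ∈ TailClassMinus 1 ∧ F ≠ Measure.dirac 0
    · obtain ⟨c, hc, C, hC, h⟩ := exists_meanHeight_bounds_one hsum hS hε hm hd1 hF.1 hF.2
      exact ⟨c, C, hc, hC, fun _ _ _ => h, by omega, by omega, by omega⟩
    · exact ⟨1, 1, one_pos, one_pos, fun _ h1 h2 => (hF ⟨h1, h2⟩).elim, by omega, by omega,
        by omega⟩
  by_cases hα : ∃ α : ℝ, 1 ≤ α ∧ F ∈ TailClass α
  swap
  · refine ⟨1, 1, one_pos, one_pos, by omega, fun _ α h1 h2 => (hα ⟨α, h1, h2⟩).elim,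
      fun _ α h1 _ h2 => (hα ⟨α, h1, h2⟩).elim, fun _ h2 => (hα ⟨_, ?_, h2⟩).elim⟩
    have : (0 : ℝ) ≤ (d : ℝ) / 2 := by positivity
    linarith
  obtain ⟨α, hα1, hF⟩ := hα
  have huniq (α' : ℝ) (h1 : 1 ≤ α') (h : F ∈ TailClass α') : α' = α :=
    tailClass_exponent_unique (by linarith) (by linarith) h hF
  by_cases hd2 : d = 2
  · obtain ⟨c, hc, C, hC, h⟩ := exists_meanHeight_bounds_two hsum hS hε hm hd2 hα1 hF
    refine ⟨c, C, hc, hC, by omega, fun _ α' h1 h2 => ?_, by omega, by omega⟩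
    rw [huniq α' h1 h2]
    exact h
  by_cases hd3 : 3 ≤ d
  swap
  -- Only d = 0 is left, where all four claims are vacuous.
  · exact ⟨1, 1, one_pos, one_pos, by omega, by omega, by omega, by omega⟩
  obtain ⟨c, hc, hlow⟩ := exists_log_rpow_le_meanHeight hsum hS hε hm hα1 hF.2
  by_cases hcrit : α = 1 + (d : ℝ) / 2
  · obtain ⟨C, hC, hup⟩ := exists_meanHeight_le_of_eq hsum hS hε hm hd3 (hcrit ▸ hF.1)
    refine ⟨c, C, hc, hC, by omega, by omega,
      fun _ α' h1 hne h2 => (hne ((huniq α' h1 h2).trans hcrit)).elim, fun _ _ n hn => ⟨?_, hup n hn⟩⟩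
    rw [show 2 / (2 + (d : ℝ)) = 1 / α by rw [hcrit]; field_simp]
    exact hlow n (by omega)
  · obtain ⟨C, hC, hup⟩ := exists_meanHeight_le_of_ne hsum hS hε hm hd3 hα1 hcrit hF.1
    refine ⟨c, C, hc, hC, by omega, by omega, fun _ α' h1 _ h2 n hn => ?_, fun _ h2 => ?_⟩
    · rw [huniq α' h1 h2]
      exact ⟨hlow n hn, hup n hn⟩
    · refine (hcrit (huniq _ ?_ h2).symm).elim
      have : (0 : ℝ) ≤ (d : ℝ) / 2 := by positivity
      linarith

/-- The mean heights coincide with those of the canonical coordinate noise, which is genuinely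
measurable. -/
theorem theorem2 {d : ℕ} (P : (Fin d → ℤ) → (Fin d → ℤ) → ℝ) (hP : IsHarnessMatrix P)
    {Ω : Type*} [MeasurableSpace Ω] (Pr : Measure Ω) [IsProbabilityMeasure Pr] (F : Measure ℝ)
    (ε : ℕ → (Fin d → ℤ) → Ω → ℝ) (hε : IsNoise Pr F ε) :
    ∃ c C : ℝ, 0 < c ∧ 0 < C ∧
      (d = 1 → F ∈ TailClassMinus 1 → F ≠ Measure.dirac 0 → ∀ n : ℕ, 2 ≤ n →
        c * (n : ℝ) ^ (1 / 4 : ℝ) ≤ meanHeight Pr P ε n ∧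
        meanHeight Pr P ε n ≤ C * (n : ℝ) ^ (1 / 4 : ℝ) * √(Real.log n)) ∧
      (d = 2 → ∀ α : ℝ, 1 ≤ α → F ∈ TailClass α → ∀ n : ℕ, 2 ≤ n →
        c * Real.log n ^ max (1 / α) (1 / 2) ≤ meanHeight Pr P ε n ∧
        meanHeight Pr P ε n ≤ C * Real.log n) ∧
      (3 ≤ d → ∀ α : ℝ, 1 ≤ α → α ≠ 1 + (d : ℝ) / 2 → F ∈ TailClass α → ∀ n : ℕ, 2 ≤ n →
        c * Real.log n ^ (1 / α) ≤ meanHeight Pr P ε n ∧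
        meanHeight Pr P ε n ≤ C * Real.log n ^ max (1 / α) (2 / (2 + (d : ℝ)))) ∧
      (3 ≤ d → F ∈ TailClass (1 + (d : ℝ) / 2) → ∀ n : ℕ, 3 ≤ n →
        c * Real.log n ^ (2 / (2 + (d : ℝ))) ≤ meanHeight Pr P ε n ∧
        meanHeight Pr P ε n ≤ C * Real.log n ^ (2 / (2 + (d : ℝ))) *
          Real.log (Real.log n) ^ ((d : ℝ) / (2 + (d : ℝ)))) := by
  have hFp : IsProbabilityMeasure F := (hε.hasLaw 0 0).isProbabilityMeasure_iff.1 inferInstance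
  obtain ⟨S, _, hsum⟩ := hP.exists_isStepLaw
  simp only [meanHeight_eq_canonical hsum hε]
  exact exists_meanHeight_bounds P hP _ F (coordNoise d) hε.coordNoise measurable_coordNoise
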